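/- **Setting.** Let $\gamma>1$, $M_\gamma=\{(\zeta_1,\zeta_2)\in\mathbb C^2:\operatorname{Im}\zeta_2=|\zeta_1|^\gamma\}$ and $\Omega_\gamma=\{(z_1,z_2)\in\mathbb C^2:\operatorname{Im}z_2>|z_1|^\gamma\}$. Parametrize $M_\gamma$ by $\zeta=(\alpha e^{i\theta},s+i\alpha^\gamma)$ with $\alpha>0$, $\theta\in[0,2\pi)$, $s\in\mathbb R$, up to the null set $\{\zeta_1=0\}$, and for $r\in\mathbb R$ let $\mu_r=\alpha^r\,d\alpha\,d\theta\,ds$ and $\sigma=\mu_{\gamma-1}$. For a function $f$ on $M_\gamma$ and $z\in\Omega_\gamma$ put $$\boldsymbol L f(z)=\frac{\gamma^2}{4\pi^2}\int_{M_\gamma}\frac{f(\zeta)\,d\sigma(\zeta)}{\left[\gamma\bar\zeta_1|\zeta_1|^{\gamma-2}(\zeta_1-z_1)+i(\zeta_2-z_2)\right]^2}.$$ The Leray transform of $f\in L^2(M_\gamma,\mu_r)$ is the boundary value of this function on $M_\gamma$, i.e. the limit in $L^2(M_\gamma,\mu_r)$, as $\varepsilon\to0^+$, of the functions $(z_1,z_2)\mapsto\boldsymbol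 Lf(z_1,z_2+i\varepsilon)$, $(z_1,z_2)\in M_\gamma$. For integers $k\ge0$ let $$C_{\mu_r}(\gamma,k)=\frac{\Gamma\big(\frac{2k+1+r}{\gamma}\big)\,\Gamma\big(2k+2-\frac{2k+1+r}{\gamma}\big)}{\Gamma(k+1)^2}\left(\frac{\gamma}{2}\right)^{2k+2}(\gamma-1)^{-\left(2k+2-\frac{2k+1+r}{\gamma}\right)}.$$ **Theorem.** Let $\gamma>1$ and $r\in\mathcal I_0=(-1,2\gamma-1)$. Then the Leray transform is a well-defined bounded linear operator $\boldsymbol L$ on all of $L^2(M_\gamma,\mu_r)$: for every $f\in L^2(M_\gamma,\mu_r)$ the integral above converges absolutely for each $z\in\Omega_\gamma$, the functions $(z_1,z_2)\mapsto\boldsymbol Lf(z_1,z_2+i\varepsilon)$, $\varepsilon>0$, belong to $L^2(M_\gamma,\mu_r)$, and their limit as $\varepsilon\to0^+$ exists there. Let $\boldsymbol L^{*}$ be the adjoint of $\boldsymbol L$ in $L^2(M_\gamma,\mu_r)$ and let $\boldsymbol T$ be either $\boldsymbol L^*\boldsymbol L$ or $\boldsymbol L\boldsymbol L^*$. Then: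 1. $L^2(M_\gamma,\mu_r)$ has an orthogonal (equivalently, orthonormal) basis of eigenfunctions of $\boldsymbol T$; 2. the set of eigenvalues of $\boldsymbol T$ (its point spectrum) is exactly $\{0\}\cup\{C_{\mu_r}(\gamma,k):k=0,1,2,\dots\}$; 3. the spectrum of $\boldsymbol T$ as a bounded operator, $\{\lambda\in\mathbb C:\boldsymbol T-\lambda I\text{ is not invertible}\}$, is the closure of that set. -/

import Mathlib

open MeasureTheory Filter Topology
open scoped ENNReal ComplexConjugate

noncomputable section

/-- The hypersurface `M_γ = {(ζ₁, ζ₂) ∈ ℂ² : Im ζ₂ = |ζ₁| ^ γ}`. -/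
def lerayHypersurface (γ : ℝ) : Set (ℂ × ℂ) := {ζ | ζ.2.im = ‖ζ.1‖ ^ γ}

/-- The domain `Ω_γ = {(z₁, z₂) ∈ ℂ² : Im z₂ > |z₁| ^ γ}` on the `ℂ`-convex side of `M_γ`. -/
def lerayDomain (γ : ℝ) : Set (ℂ × ℂ) := {z | ‖z.1‖ ^ γ < z.2.im}

/-- The parametrization `(α, θ, s) ↦ (α e^{iθ}, s + i α ^ γ)` of `M_γ`.  It is only used for `0 < α`
(the absolute value makes it a total function). -/
def lerayParam (γ : ℝ) (p : ℝ × ℝ × ℝ) : lerayHypersurface γ :=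
  ⟨((p.1 : ℂ) * Complex.exp ((p.2.1 : ℂ) * Complex.I),
      (p.2.2 : ℂ) + ((|p.1| ^ γ : ℝ) : ℂ) * Complex.I), by
    simp [lerayHypersurface, Complex.norm_exp_ofReal_mul_I]⟩

/-- The parametrization is measurable, so that it can be used to push measures forward to `M_γ`. -/
theorem measurable_lerayParam (γ : ℝ) : Measurable (lerayParam γ) := by
  apply Measurable.subtype_mk
  fun_prop

/-- The measure `μ_r = α ^ r dα dθ ds` on `M_γ`, where `0 < α`, `θ ∈ [0, 2π)`, `s ∈ ℝ`. -/
def lerayMeasure (γ r : ℝ) : Measure (lerayHypersurface γ) :=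
  Measure.map (lerayParam γ)
    (((volume.restrict (Set.Ioi (0 : ℝ))).withDensity fun α => ENNReal.ofReal (α ^ r)).prod
      ((volume.restrict (Set.Ico (0 : ℝ) (2 * Real.pi))).prod volume))

/-- The Hilbert space `L²(M_γ, μ_r)` of complex-valued functions. -/
abbrev LerayL2 (γ r : ℝ) : Type := Lp ℂ 2 (lerayMeasure γ r)

/-- The Leray kernel of `M_γ` with respect to the measure `σ = μ_{γ-1}`:
`(γ² / 4π²) · [γ ζ̄₁ |ζ₁| ^ (γ-2) (ζ₁ - z₁) + i (ζ₂ - z₂)]⁻²`.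
(As a form, `σ = (1 / 2i) |ζ₁| ^ (γ-2) dζ₂ ∧ dζ̄₁ ∧ dζ₁`.) -/
def lerayKernel (γ : ℝ) (z ζ : ℂ × ℂ) : ℂ :=
  (γ : ℂ) ^ 2 / (4 * (Real.pi : ℂ) ^ 2) /
    ((γ : ℂ) * conj ζ.1 * ((‖ζ.1‖ ^ (γ - 2) : ℝ) : ℂ) * (ζ.1 - z.1)
      + Complex.I * (ζ.2 - z.2)) ^ 2

/-- The Leray integral of a function `f` on `M_γ`, evaluated at a point `z` of `Ω_γ`. -/
def lerayIntegral (γ : ℝ) (f : lerayHypersurface γ → ℂ) (z : ℂ × ℂ) : ℂ :=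
  ∫ ζ, f ζ * lerayKernel γ z ζ ∂(lerayMeasure γ (γ - 1))

/-- The Leray integral of `f` on the translate `M_γ + (0, iε)` of `M_γ`, as a function on `M_γ`. -/
def lerayShift (γ ε : ℝ) (f : lerayHypersurface γ → ℂ) (z : lerayHypersurface γ) : ℂ :=
  lerayIntegral γ f (z.1.1, z.1.2 + (ε : ℂ) * Complex.I)

/-- `g ∈ L²(M_γ, μ_r)` is the Leray transform of `f ∈ L²(M_γ, μ_r)`: the Leray integral of `f`
converges absolutely on `Ω_γ`, it is square integrable on each translate `M_γ + (0, iε)`, `ε > 0`,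
and `g` is its boundary value on `M_γ`, in the sense of `L²` convergence as `ε → 0+`. -/
structure IsLerayTransform (γ r : ℝ) (f g : LerayL2 γ r) : Prop where
  integrable : ∀ z ∈ lerayDomain γ,
    Integrable (fun ζ : lerayHypersurface γ => f ζ * lerayKernel γ z ζ) (lerayMeasure γ (γ - 1))
  memLp : ∀ ε : ℝ, 0 < ε → MemLp (lerayShift γ ε f) 2 (lerayMeasure γ r)
  tendsto : Tendsto (fun ε : ℝ => eLpNorm (lerayShift γ ε f - ⇑g) 2 (lerayMeasure γ r))
    (𝓝[>] 0) (𝓝 0)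

/-- The Leray transform is unique, so that it is a well-defined (partial) operator. -/
theorem IsLerayTransform.unique {γ r : ℝ} {f g h : LerayL2 γ r}
    (hg : IsLerayTransform γ r f g) (hh : IsLerayTransform γ r f h) : g = h := by
  have key : ∀ ε ∈ Set.Ioi (0 : ℝ), eLpNorm (⇑g - ⇑h) 2 (lerayMeasure γ r) ≤
      eLpNorm (lerayShift γ ε f - ⇑g) 2 (lerayMeasure γ r) +
      eLpNorm (lerayShift γ ε f - ⇑h) 2 (lerayMeasure γ r) := by
    intro ε hε
    have hm := (hg.memLp ε hε).aestronglyMeasurable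
    have e : (⇑g - ⇑h) = (lerayShift γ ε f - ⇑h) - (lerayShift γ ε f - ⇑g) := by
      funext x; simp
    rw [e, add_comm]
    exact eLpNorm_sub_le (hm.sub (Lp.aestronglyMeasurable h))
      (hm.sub (Lp.aestronglyMeasurable g)) (by norm_num)
  have lim := hg.tendsto.add hh.tendsto
  rw [add_zero] at lim
  have hz : eLpNorm (⇑g - ⇑h) 2 (lerayMeasure γ r) ≤ 0 :=
    ge_of_tendsto lim (eventually_mem_nhdsWithin.mono key)
  have h0 := (eLpNorm_eq_zero_iff
    ((Lp.aestronglyMeasurable g).sub (Lp.aestronglyMeasurable h)) (by norm_num)).1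
    (le_antisymm hz zero_le)
  exact Lp.ext (h0.mono fun x hx => sub_eq_zero.1 hx)

/-- The `μ_r`-symbol function `C_{μ_r}(γ, k)`. -/
def leraySymbol (γ r : ℝ) (k : ℕ) : ℝ :=
  Real.Gamma ((2 * k + 1 + r) / γ) * Real.Gamma (2 * k + 2 - (2 * k + 1 + r) / γ)
      / Real.Gamma (k + 1) ^ 2
    * (γ / 2) ^ (2 * k + 2) * (γ - 1) ^ (-(2 * k + 2 - (2 * k + 1 + r) / γ))

end

/-! Fourier analysis in θ and s diagonalizes the Leray transform. For an angular frequency m, the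
functions e^{imθ} α^a ∫₀^∞ g(ξ) c ξ^{p/2} e^{-lα^γ ξ} e^{iξs} dξ with γp = r + 2a + 1 and c =
`modeConst` depend isometrically on g ∈ L²(0,∞) (`modeIsometry`), by Plancherel in s and a Gamma
integral in α. Different m give orthogonal ranges.

Two families with m = k ≥ 0 matter. Put q = (2k+1+r)/γ. The isometries V_k (`rangeMode`: p = q, a =
k, l = 1) produce boundary values of z₁^k ∫ (...) e^{iξz₂} dξ. The isometries W_k (`sourceMode`: p =
2k+2-q, a = (γ-1)(k+1)-r, l = γ-1) come from the kernel: the conjugate of its denominator is (P -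
Q)², with P free of z₁ and Q linear in conj z₁. Young's inequality gives |Q| < Re P on Ω_γ, so
1/(P-Q)² = Σ (k+1)Q^k/P^{k+2}, and each power of 1/P is a Laplace integral in ξ. Thus α^{γ-1-r}
times the conjugate kernel is a sum of W_k applied to profiles depending on z
(`sourceMode_lerayProfile`), while pairing with these profiles evaluates V_k (`inner_lerayProfile`).
The factor √C_k, with C_k the symbol, is what reconciles the normalizing constants with the kernel
coefficients (`sqrt_leraySymbol_mul_modeConst`).

Hence the Leray integral on the translate by iε is Σ √C_k V_k e^{-εξ} W_k* (`lerayShift_ae_eq`).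
Stirling bounds C_k (`exists_leraySymbol_le`), so ε → 0 gives L = Σ √C_k V_k W_k*. Then L*L = Σ C_k
W_k W_k* and LL* = Σ C_k V_k V_k*, and both vanish on the angular frequency -1. An eigenbasis with
eigenvalue set {0} ∪ {C_k} (`exists_eigenbasis_weightedSum`) determines the point spectrum and the
spectrum (`spectrum_of_eigenbasis`). -/

noncomputable section

/-! ### Plancherel's theorem for Fourier integrals. -/

open FourierTransform SchwartzMap in
/-- The `L²` Fourier transform of a function in `L¹ ∩ L²` is given by the Fourier integral. -/
theorem MeasureTheory.MemLp.fourier_toLp_ae_eq {f : ℝ → ℂ} (hf1 : Integrable f) (hf2 : MemLp f 2) :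
    (𝓕 (hf2.toLp f) : Lp ℂ 2 (volume : Measure ℝ)) =ᵐ[volume] 𝓕 f := by
  have hc : Continuous (𝓕 f) := VectorFourier.fourierIntegral_continuous
    Real.continuous_fourierChar continuous_inner hf1
  refine ae_eq_of_integral_contDiff_smul_eq
    ((Lp.memLp _).locallyIntegrable (by norm_num)) hc.locallyIntegrable ?_
  intro φ hφ hφc
  have hφ' := Complex.ofRealCLM.contDiff.comp hφ
  have hφc' : HasCompactSupport (Complex.ofRealCLM ∘ φ) :=
    hφc.comp_left (g := Complex.ofRealCLM) (by simp)
  let ψ : 𝓢(ℝ, ℂ) := hφc'.toSchwartzMap hφ'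
  have hψ (x : ℝ) : ψ x = (φ x : ℂ) := rfl
  -- Both transforms pass to the test function under the integral: the L² one as a tempered
  -- distribution, the Fourier integral by Fubini.
  have h := congrArg (fun T => T ψ) (Lp.fourier_toTemperedDistribution_eq (hf2.toLp f))
  simp only [TemperedDistribution.fourier_apply, Lp.toTemperedDistribution_apply] at h
  have h1 : ∫ x, φ x • (𝓕 (hf2.toLp f) : Lp ℂ 2 (volume : Measure ℝ)) x =
      ∫ x, ψ x • (𝓕 (hf2.toLp f) : Lp ℂ 2 (volume : Measure ℝ)) x := by
    simp [hψ]
  rw [h1, ← h]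
  have h2 := VectorFourier.integral_fourierIntegral_smul_eq_flip (L := innerₗ ℝ) (f := ψ) (g := f)
    Real.continuous_fourierChar continuous_inner (ψ.integrable (μ := volume)) hf1
  rw [flip_innerₗ] at h2
  calc ∫ x, (𝓕 ψ) x • (hf2.toLp f) x = ∫ x, (𝓕 ψ) x • f x := by
        refine integral_congr_ae ?_
        filter_upwards [hf2.coeFn_toLp] with x hx
        rw [hx]
    _ = ∫ x, ψ x • 𝓕 f x := h2
    _ = _ := by simp [hψ]

open FourierTransform in
/-- Plancherel's theorem for functions in `L¹ ∩ L²`. -/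
theorem lintegral_enorm_fourier_sq {f : ℝ → ℂ} (hf1 : Integrable f) (hf2 : MemLp f 2) :
    ∫⁻ x, ‖𝓕 f x‖ₑ ^ 2 = ∫⁻ x, ‖f x‖ₑ ^ 2 := by
  have h : eLpNorm (𝓕 f) 2 volume = eLpNorm f 2 volume := by
    rw [← eLpNorm_congr_ae (hf2.fourier_toLp_ae_eq hf1), ← Lp.enorm_def, ← eLpNorm_congr_ae hf2.coeFn_toLp,
      ← Lp.enorm_def, ← ofReal_norm, Lp.norm_fourier_eq, ofReal_norm]
  rw [eLpNorm_eq_lintegral_rpow_enorm_toReal (by simp) (by simp),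
    eLpNorm_eq_lintegral_rpow_enorm_toReal (by simp) (by simp)] at h
  have := ENNReal.rpow_left_injective (x := 1 / (2 : ℝ≥0∞).toReal) (by simp) h
  simpa using this

/-- Plancherel's theorem for the Fourier transform with the convention
`f ↦ ∫ f(ξ) e ^ {iξs} dξ`. -/
theorem lintegral_enorm_integral_exp_sq {f : ℝ → ℂ} (hf1 : Integrable f) (hf2 : MemLp f 2) :
    ∫⁻ s : ℝ, ‖∫ ξ, f ξ * Complex.exp (Complex.I * ξ * s)‖ₑ ^ 2 =
      ENNReal.ofReal (2 * Real.pi) * ∫⁻ ξ, ‖f ξ‖ₑ ^ 2 := by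
  have hpi : (-(2 * Real.pi))⁻¹ ≠ 0 := by simp [Real.pi_ne_zero]
  rw [← lintegral_enorm_fourier_sq hf1 hf2]
  have h1 (s : ℝ) : ∫ ξ, f ξ * Complex.exp (Complex.I * ξ * s) =
      FourierTransform.fourier f ((-(2 * Real.pi))⁻¹ * s) := by
    rw [Real.fourier_eq']
    refine integral_congr_ae (.of_forall fun ξ => ?_)
    simp only [smul_eq_mul]
    rw [mul_comm]
    congr 2
    simp
    field_simp
  simp_rw [h1]
  have h2 := lintegral_map_equiv (μ := (volume : Measure ℝ))
    (fun y => ‖FourierTransform.fourier f y‖ₑ ^ 2)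
    (Homeomorph.mulLeft₀ (-(2 * Real.pi))⁻¹ hpi).toMeasurableEquiv
  simp only [Homeomorph.toMeasurableEquiv_coe, Homeomorph.coe_mulLeft₀] at h2
  rw [← h2, Real.map_volume_mul_left hpi, lintegral_smul_measure]
  congr 2
  simp [abs_of_pos Real.pi_pos]

/-! ### The measures μ_r in coordinates. -/

theorem lintegral_lerayMeasure {γ r : ℝ} {F : lerayHypersurface γ → ℝ≥0∞} (hF : Measurable F) :
    ∫⁻ ζ, F ζ ∂lerayMeasure γ r = ∫⁻ α in Set.Ioi (0 : ℝ), ENNReal.ofReal (α ^ r) *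
      ∫⁻ q, F (lerayParam γ (α, q))
        ∂((volume.restrict (Set.Ico (0 : ℝ) (2 * Real.pi))).prod volume) := by
  have hm : Measurable fun x => F (lerayParam γ x) := hF.comp (measurable_lerayParam γ)
  rw [lerayMeasure, lintegral_map hF (measurable_lerayParam γ),
    lintegral_prod _ hm.aemeasurable, lintegral_withDensity_eq_lintegral_mul _ (by fun_prop)]
  · rfl
  · exact hm.lintegral_prod_right'

/-- Used with r' = γ - 1: the Leray integral is taken against σ, but has to become an inner product
in L²(μ_r). -/
theorem lerayMeasure_withDensity (γ r r' : ℝ) :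
    lerayMeasure γ r' =
      (lerayMeasure γ r).withDensity fun ζ => ENNReal.ofReal (‖ζ.1.1‖ ^ (r' - r)) := by
  ext S hS
  have hm : Measurable fun ζ : lerayHypersurface γ => ENNReal.ofReal (‖ζ.1.1‖ ^ (r' - r)) := by
    fun_prop
  rw [withDensity_apply _ hS, ← lintegral_indicator_one hS, ← lintegral_indicator hS,
    lintegral_lerayMeasure (measurable_one.indicator hS),
    lintegral_lerayMeasure (hm.indicator hS)]
  refine setLIntegral_congr_fun measurableSet_Ioi fun α hα => ?_
  have hα : 0 < α := hα
  have e (q : ℝ × ℝ) : S.indicator (fun ζ : lerayHypersurface γ =>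
      ENNReal.ofReal (‖ζ.1.1‖ ^ (r' - r))) (lerayParam γ (α, q)) =
      ENNReal.ofReal (α ^ (r' - r)) * S.indicator 1 (lerayParam γ (α, q)) := by
    have : ‖(lerayParam γ (α, q)).1.1‖ = α := by
      simp [lerayParam, Complex.norm_exp_ofReal_mul_I, abs_of_pos hα]
    by_cases hq : lerayParam γ (α, q) ∈ S <;> simp [hq, this]
  simp only [e]
  rw [lintegral_const_mul, ← mul_assoc, ← ENNReal.ofReal_mul (by positivity),
    ← Real.rpow_add hα, add_sub_cancel]
  exact (measurable_one.indicator hS).comp ((measurable_lerayParam γ).comp (by fun_prop))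

theorem ae_lerayMeasure_ne_zero (γ r : ℝ) : ∀ᵐ ζ ∂lerayMeasure γ r, ζ.1.1 ≠ 0 := by
  have hS : MeasurableSet {ζ : lerayHypersurface γ | ζ.1.1 = 0} :=
    measurableSet_eq_fun (by fun_prop) (by fun_prop)
  rw [ae_iff]
  simp only [not_not]
  rw [← lintegral_indicator_one hS, lintegral_lerayMeasure (measurable_one.indicator hS),
    setLIntegral_congr_fun (g := fun _ => 0) measurableSet_Ioi]
  · simp
  · intro α hα
    have hα : α ≠ 0 := ne_of_gt hα
    simp [Set.indicator, lerayParam, hα]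

/-! ### Modes as isometric images of L²(0,∞). -/

theorem Real.rpow_mul_exp_neg_mul_le {q c x : ℝ} (hq : 0 < q) (hc : 0 < c) (hx : 0 ≤ x) :
    x ^ q * Real.exp (-(c * x)) ≤ (q / c) ^ q := by
  -- The inequality t ≤ e^t at t = cx/q, to be raised to the power q.
  have h : c / q * x ≤ Real.exp (c / q * x) := by linarith [Real.add_one_le_exp (c / q * x)]
  have h' := Real.rpow_le_rpow (by positivity) h hq.le
  rw [← Real.exp_mul, Real.mul_rpow (by positivity) hx,
    show c / q * x * q = c * x by field_simp] at h'
  rw [Real.exp_neg, ← div_eq_mul_inv, div_le_iff₀ (Real.exp_pos _)]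
  calc x ^ q = (q / c) ^ q * ((c / q) ^ q * x ^ q) := by
        rw [← mul_assoc, ← Real.mul_rpow (by positivity) (by positivity)]
        field_simp
        simp
    _ ≤ _ := by gcongr

/-- The `L²` space of the half-line of frequencies. -/
abbrev HalfLineL2 : Type := Lp ℂ 2 (volume.restrict (Set.Ioi (0 : ℝ)))

/-- The factor that normalizes the modes on the hypersurface. -/
def modeConst (γ p l : ℝ) : ℝ := √(γ * (2 * l) ^ p / (4 * Real.pi ^ 2 * Real.Gamma p))

/-- The integrand of a mode with frequency profile `g`. -/
def modeIntegrand (γ p l : ℝ) (g : ℝ → ℂ) (α s ξ : ℝ) : ℂ :=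
  g ξ * ((modeConst γ p l * ξ ^ (p / 2) * Real.exp (-(l * α ^ γ * ξ)) : ℝ) : ℂ) *
    Complex.exp (Complex.I * ξ * s)

/-- The mode on the hypersurface with angular frequency `m`, radial exponent `a`, decay rate `l`
and frequency profile `g`. -/
def modeFun (γ p a l : ℝ) (m : ℤ) (g : ℝ → ℂ) (ζ : lerayHypersurface γ) : ℂ :=
  (ζ.1.1 / ‖ζ.1.1‖) ^ m * ((‖ζ.1.1‖ ^ a : ℝ) : ℂ) *
    ∫ ξ in Set.Ioi (0 : ℝ), modeIntegrand γ p l g ‖ζ.1.1‖ ζ.1.2.re ξ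

/-- Here the weight acts as a bounded multiplier; in `integrable_mul_modeWeight` it is paired with g
as an L² function. Plancherel for L¹ ∩ L² needs both. -/
theorem memLp_mul_modeWeight {γ p l : ℝ} (hp : 0 < p) {c : ℝ} (hc : 0 < c)
    {g : ℝ → ℂ} (hg : MemLp g 2 (volume.restrict (Set.Ioi (0 : ℝ)))) :
    MemLp (fun ξ => g ξ * ((modeConst γ p l * ξ ^ (p / 2) * Real.exp (-(c * ξ)) : ℝ) : ℂ)) 2
      (volume.restrict (Set.Ioi (0 : ℝ))) := by
  refine MemLp.mul (p := 2) (q := ∞) (r := 2) ?_ hg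
  refine memLp_top_of_bound (by fun_prop) (modeConst γ p l * (p / 2 / c) ^ (p / 2)) ?_
  filter_upwards [ae_restrict_mem measurableSet_Ioi] with ξ hξ
  have hξ : 0 < ξ := hξ
  have h0 : 0 ≤ modeConst γ p l := Real.sqrt_nonneg _
  rw [Complex.norm_real, Real.norm_of_nonneg (by positivity), mul_assoc]
  gcongr
  exact Real.rpow_mul_exp_neg_mul_le (by positivity) hc hξ.le

theorem memLp_rpow_mul_exp {q c : ℝ} (hq : -1 < q) (hc : 0 < c) :
    MemLp (fun ξ : ℝ => ((ξ ^ (q / 2) * Real.exp (-(c * ξ)) : ℝ) : ℂ)) 2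
      (volume.restrict (Set.Ioi (0 : ℝ))) := by
  rw [memLp_two_iff_integrable_sq_norm (by fun_prop)]
  have h := integrableOn_rpow_mul_exp_neg_mul_rpow (s := q) (p := 1) (b := 2 * c) hq one_pos
    (by positivity)
  refine h.congr ?_
  filter_upwards [ae_restrict_mem measurableSet_Ioi] with ξ hξ
  have hξ : 0 < ξ := hξ
  rw [Complex.norm_real, Real.norm_of_nonneg (by positivity), mul_pow, ← Real.rpow_mul_natCast hξ.le,
    ← Real.exp_nat_mul]
  simp
  left
  ring

theorem integrable_mul_modeWeight {γ p l : ℝ} (hp : 0 < p) {c : ℝ} (hc : 0 < c)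
    {g : ℝ → ℂ} (hg : MemLp g 2 (volume.restrict (Set.Ioi (0 : ℝ)))) :
    Integrable (fun ξ => g ξ * ((modeConst γ p l * ξ ^ (p / 2) * Real.exp (-(c * ξ)) : ℝ) : ℂ))
      (volume.restrict (Set.Ioi (0 : ℝ))) := by
  refine MemLp.integrable_mul (p := 2) (q := 2) hg ?_
  have := (memLp_rpow_mul_exp (by linarith : -1 < p) hc).const_mul (modeConst γ p l : ℂ)
  refine this.congr_norm (by fun_prop) (.of_forall fun ξ => ?_)
  simp [mul_assoc]

theorem integrable_modeIntegrand {γ p l : ℝ} (hp : 0 < p) (hl : 0 < l) {α : ℝ} (hα : 0 < α)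
    (s : ℝ) {g : ℝ → ℂ} (hg : MemLp g 2 (volume.restrict (Set.Ioi (0 : ℝ)))) :
    Integrable (modeIntegrand γ p l g α s) (volume.restrict (Set.Ioi (0 : ℝ))) := by
  have h := integrable_mul_modeWeight (γ := γ) (l := l) hp (c := l * α ^ γ) (by positivity) hg
  refine h.congr' (h.1.mul (by fun_prop)) (.of_forall fun ξ => ?_)
  have : ‖Complex.exp (Complex.I * ξ * s)‖ = 1 := by
    rw [show Complex.I * ξ * s = ((ξ * s : ℝ) : ℂ) * Complex.I by push_cast; ring,
      Complex.norm_exp_ofReal_mul_I]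
  simp [modeIntegrand, this]

theorem lintegral_modeIntegral_sq {γ p l : ℝ} (hp : 0 < p) (hl : 0 < l) {α : ℝ} (hα : 0 < α)
    {g : ℝ → ℂ} (hg : MemLp g 2 (volume.restrict (Set.Ioi (0 : ℝ)))) :
    ∫⁻ s : ℝ, ‖∫ ξ in Set.Ioi (0 : ℝ), modeIntegrand γ p l g α s ξ‖ₑ ^ 2 =
      ENNReal.ofReal (2 * Real.pi) * ∫⁻ ξ in Set.Ioi (0 : ℝ), ‖g ξ‖ₑ ^ 2 *
        ENNReal.ofReal (modeConst γ p l ^ 2 * ξ ^ p * Real.exp (-(2 * l * ξ) * α ^ γ)) := by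
  have hc : 0 < l * α ^ γ := by positivity
  set f : ℝ → ℂ := (Set.Ioi (0 : ℝ)).indicator (fun ξ => g ξ *
    ((modeConst γ p l * ξ ^ (p / 2) * Real.exp (-(l * α ^ γ * ξ)) : ℝ) : ℂ)) with hf
  have h := lintegral_enorm_integral_exp_sq (f := f)
    ((integrable_indicator_iff measurableSet_Ioi).2 (integrable_mul_modeWeight hp hc hg))
    ((memLp_indicator_iff_restrict measurableSet_Ioi).2 (memLp_mul_modeWeight hp hc hg))
  have e1 (s : ℝ) : ∫ ξ in Set.Ioi (0 : ℝ), modeIntegrand γ p l g α s ξ =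
      ∫ ξ, f ξ * Complex.exp (Complex.I * ξ * s) := by
    rw [← integral_indicator measurableSet_Ioi]
    congr 1 with ξ
    by_cases hξ : ξ ∈ Set.Ioi (0 : ℝ) <;> simp [hf, hξ, modeIntegrand]
  simp only [e1, h]
  rw [← lintegral_indicator measurableSet_Ioi]
  congr 2 with ξ
  by_cases hξ : ξ ∈ Set.Ioi (0 : ℝ)
  · have hξ' : 0 < ξ := hξ
    simp only [hf, hξ, Set.indicator_of_mem, enorm_mul, mul_pow]
    congr 1
    have h0 : 0 ≤ modeConst γ p l := Real.sqrt_nonneg _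
    rw [← ofReal_norm, Complex.norm_real, Real.norm_of_nonneg (by positivity),
      ← ENNReal.ofReal_pow (by positivity), mul_pow, mul_pow, ← Real.rpow_mul_natCast hξ'.le,
      ← Real.exp_nat_mul]
    congr 2
    · simp
    · congr 1
      push_cast
      ring
  · simp [hf, hξ]

theorem stronglyMeasurable_modeIntegral {γ p l : ℝ} {g : ℝ → ℂ} (hg : StronglyMeasurable g) :
    StronglyMeasurable fun q : ℝ × ℝ =>
      ∫ ξ in Set.Ioi (0 : ℝ), modeIntegrand γ p l g q.1 q.2 ξ := by
  refine StronglyMeasurable.integral_prod_right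
    (f := fun (q : ℝ × ℝ) ξ => modeIntegrand γ p l g q.1 q.2 ξ) ?_
  have : Measurable g := hg.measurable
  refine Measurable.stronglyMeasurable ?_
  unfold modeIntegrand Function.uncurry
  fun_prop

theorem measurable_modeFun {γ p a l : ℝ} {m : ℤ} {g : ℝ → ℂ} (hg : StronglyMeasurable g) :
    Measurable (modeFun γ p a l m g) := by
  have h6 : Measurable ((fun q : ℝ × ℝ =>
      ∫ ξ in Set.Ioi (0 : ℝ), modeIntegrand γ p l g q.1 q.2 ξ) ∘
      fun ζ : lerayHypersurface γ => (‖ζ.1.1‖, ζ.1.2.re)) :=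
    (stronglyMeasurable_modeIntegral (γ := γ) (p := p) (l := l) hg).measurable.comp (by fun_prop)
  have h5 : Measurable fun ζ : lerayHypersurface γ => (ζ.1.1 / ‖ζ.1.1‖) ^ m *
      ((‖ζ.1.1‖ ^ a : ℝ) : ℂ) := by
    refine Measurable.mul (Measurable.pow_const ?_ m) ?_ <;> fun_prop
  exact h5.mul h6

theorem modeFun_lerayParam {γ p a l : ℝ} {m : ℤ} {g : ℝ → ℂ} {α : ℝ} (hα : 0 < α) (θ s : ℝ) :
    modeFun γ p a l m g (lerayParam γ (α, θ, s)) =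
      Complex.exp (θ * Complex.I) ^ m * ((α ^ a : ℝ) : ℂ) *
        ∫ ξ in Set.Ioi (0 : ℝ), modeIntegrand γ p l g α s ξ := by
  have h1 : ‖(lerayParam γ (α, θ, s)).1.1‖ = α := by
    simp [lerayParam, Complex.norm_exp_ofReal_mul_I, abs_of_pos hα]
  have h2 : (lerayParam γ (α, θ, s)).1.2.re = s := by simp [lerayParam]
  have hα' : (α : ℂ) ≠ 0 := by exact_mod_cast hα.ne'
  unfold modeFun
  rw [h1, h2]
  congr 3
  simp [lerayParam, hα']

/-- The substitution t = 2lξα^γ turns this into a Gamma integral, whose value fixes `modeConst`. One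
factor 2π in 4π² is the Plancherel constant, the other the length of the circle. -/
theorem lintegral_modeWeight {γ p a l r : ℝ} (hγ : 1 < γ) (hp : 0 < p) (hl : 0 < l)
    (hpa : γ * p = r + 2 * a + 1) {ξ : ℝ} (hξ : 0 < ξ) :
    ∫⁻ α in Set.Ioi (0 : ℝ), ENNReal.ofReal (4 * Real.pi ^ 2 * (α ^ (r + 2 * a) *
      (modeConst γ p l ^ 2 * ξ ^ p * Real.exp (-(2 * l * ξ) * α ^ γ)))) = 1 := by
  have hG := Real.Gamma_pos_of_pos hp
  have hpi := Real.pi_pos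
  have hq : -1 < r + 2 * a := by nlinarith
  have h1 := integral_rpow_mul_exp_neg_mul_rpow (p := γ) (q := r + 2 * a) (b := 2 * l * ξ)
    (by linarith) hq (by positivity)
  have h2 := integrableOn_rpow_mul_exp_neg_mul_rpow (p := γ) (s := r + 2 * a) (b := 2 * l * ξ)
    hq (by linarith) (by positivity)
  have e (α : ℝ) : 4 * Real.pi ^ 2 * (α ^ (r + 2 * a) *
      (modeConst γ p l ^ 2 * ξ ^ p * Real.exp (-(2 * l * ξ) * α ^ γ))) =
      4 * Real.pi ^ 2 * modeConst γ p l ^ 2 * ξ ^ p *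
        (α ^ (r + 2 * a) * Real.exp (-(2 * l * ξ) * α ^ γ)) := by ring
  simp only [e]
  rw [← ofReal_integral_eq_lintegral_ofReal (h2.const_mul _), integral_const_mul, h1]
  · rw [modeConst, Real.sq_sqrt (by positivity), ← hpa, neg_div,
      mul_div_cancel_left₀ p (by linarith), Real.rpow_neg (by positivity),
      Real.mul_rpow (by positivity) hξ.le, ENNReal.ofReal_eq_one]
    have := Real.rpow_pos_of_pos (by positivity : 0 < 2 * l) p
    have := Real.rpow_pos_of_pos hξ p
    field_simp
  · filter_upwards [ae_restrict_mem measurableSet_Ioi] with α hα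
    have hα : 0 < α := hα
    positivity

/-- Plancherel in s at fixed α, then Tonelli: for each ξ the remaining α-integral is 1, whatever g
is. -/
theorem lintegral_modeFun_sq {γ p a l r : ℝ} (hγ : 1 < γ) (hp : 0 < p) (hl : 0 < l)
    (hpa : γ * p = r + 2 * a + 1) (m : ℤ) {g : ℝ → ℂ} (hgm : StronglyMeasurable g)
    (hg : MemLp g 2 (volume.restrict (Set.Ioi (0 : ℝ)))) :
    ∫⁻ ζ, ‖modeFun γ p a l m g ζ‖ₑ ^ 2 ∂lerayMeasure γ r =
      ∫⁻ ξ in Set.Ioi (0 : ℝ), ‖g ξ‖ₑ ^ 2 := by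
  have hgm' := hgm.measurable
  rw [lintegral_lerayMeasure ((measurable_modeFun hgm).enorm.pow_const 2)]
  have hpi := Real.pi_pos
  calc _ = ∫⁻ α in Set.Ioi (0 : ℝ), ∫⁻ ξ in Set.Ioi (0 : ℝ), ‖g ξ‖ₑ ^ 2 *
        ENNReal.ofReal (4 * Real.pi ^ 2 * (α ^ (r + 2 * a) *
          (modeConst γ p l ^ 2 * ξ ^ p * Real.exp (-(2 * l * ξ) * α ^ γ)))) := by
        refine setLIntegral_congr_fun measurableSet_Ioi fun α hα => ?_
        have hα : 0 < α := hα
        have e1 (q : ℝ × ℝ) : ‖modeFun γ p a l m g (lerayParam γ (α, q))‖ₑ ^ 2 =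
            ENNReal.ofReal (α ^ (2 * a)) *
              ‖∫ ξ in Set.Ioi (0 : ℝ), modeIntegrand γ p l g α q.2 ξ‖ₑ ^ 2 := by
          rw [modeFun_lerayParam hα, enorm_mul, mul_pow]
          congr 1
          rw [← ofReal_norm, norm_mul, norm_zpow, Complex.norm_exp_ofReal_mul_I,
            Complex.norm_real, Real.norm_of_nonneg (by positivity),
            ← ENNReal.ofReal_pow (by positivity), one_zpow, one_mul,
            ← Real.rpow_mul_natCast hα.le]
          congr 2
          push_cast
          ring
        have hm : Measurable fun s : ℝ =>
            ‖∫ ξ in Set.Ioi (0 : ℝ), modeIntegrand γ p l g α s ξ‖ₑ ^ 2 :=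
          (((stronglyMeasurable_modeIntegral hgm).comp_measurable
            (g := fun s : ℝ => (α, s)) (by fun_prop)).measurable.enorm).pow_const 2
        have hm' : Measurable fun q : ℝ × ℝ =>
            ‖∫ ξ in Set.Ioi (0 : ℝ), modeIntegrand γ p l g α q.2 ξ‖ₑ ^ 2 :=
          hm.comp measurable_snd
        simp only [e1]
        rw [lintegral_const_mul _ hm', lintegral_prod _ hm'.aemeasurable]
        simp only [lintegral_const, lintegral_modeIntegral_sq hp hl hα hg,
          Measure.restrict_apply_univ, Real.volume_Ico, sub_zero]
        rw [← lintegral_const_mul _ (by fun_prop), ← lintegral_mul_const _ (by fun_prop),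
          ← lintegral_const_mul _ (by fun_prop), ← lintegral_const_mul _ (by fun_prop)]
        refine setLIntegral_congr_fun measurableSet_Ioi fun ξ hξ => ?_
        have hξ : 0 < ξ := hξ
        have : 4 * Real.pi ^ 2 * (α ^ (r + 2 * a) *
            (modeConst γ p l ^ 2 * ξ ^ p * Real.exp (-(2 * l * ξ) * α ^ γ))) =
            α ^ r * (α ^ (2 * a) * (2 * Real.pi * (modeConst γ p l ^ 2 * ξ ^ p *
              Real.exp (-(2 * l * ξ) * α ^ γ)) * (2 * Real.pi))) := by
          rw [Real.rpow_add hα]; ring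
        simp only [this]
        have key (A B C X : ℝ) (G : ℝ≥0∞) (hA : 0 ≤ A) (hB : 0 ≤ B) (hC : 0 ≤ C) (hX : 0 ≤ X) :
            ENNReal.ofReal A * (ENNReal.ofReal B *
              (ENNReal.ofReal C * (G * ENNReal.ofReal X) * ENNReal.ofReal C)) =
            G * ENNReal.ofReal (A * (B * (C * X * C))) := by
          rw [ENNReal.ofReal_mul hA, ENNReal.ofReal_mul hB, ENNReal.ofReal_mul (by positivity),
            ENNReal.ofReal_mul hC]
          ring
        exact key _ _ _ _ _ (by positivity) (by positivity) (by positivity) (by positivity)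
    _ = ∫⁻ ξ in Set.Ioi (0 : ℝ), ∫⁻ α in Set.Ioi (0 : ℝ), ‖g ξ‖ₑ ^ 2 *
        ENNReal.ofReal (4 * Real.pi ^ 2 * (α ^ (r + 2 * a) *
          (modeConst γ p l ^ 2 * ξ ^ p * Real.exp (-(2 * l * ξ) * α ^ γ)))) := by
        refine lintegral_lintegral_swap (Measurable.aemeasurable ?_)
        unfold Function.uncurry
        fun_prop
    _ = _ := by
        refine setLIntegral_congr_fun measurableSet_Ioi fun ξ hξ => ?_
        rw [lintegral_const_mul _ (by fun_prop), lintegral_modeWeight hγ hp hl hpa hξ, mul_one]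

theorem eLpNorm_modeFun {γ p a l r : ℝ} (hγ : 1 < γ) (hp : 0 < p) (hl : 0 < l)
    (hpa : γ * p = r + 2 * a + 1) (m : ℤ) (g : HalfLineL2) :
    eLpNorm (modeFun γ p a l m g) 2 (lerayMeasure γ r) =
      eLpNorm g 2 (volume.restrict (Set.Ioi (0 : ℝ))) := by
  have h := lintegral_modeFun_sq hγ hp hl hpa m (Lp.stronglyMeasurable g) (Lp.memLp g)
  rw [eLpNorm_eq_lintegral_rpow_enorm_toReal (by simp) (by simp),
    eLpNorm_eq_lintegral_rpow_enorm_toReal (by simp) (by simp)]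
  simpa using congrArg (fun x => x ^ (1 / 2 : ℝ)) h

theorem memLp_modeFun {γ p a l r : ℝ} (hγ : 1 < γ) (hp : 0 < p) (hl : 0 < l)
    (hpa : γ * p = r + 2 * a + 1) (m : ℤ) (g : HalfLineL2) :
    MemLp (modeFun γ p a l m g) 2 (lerayMeasure γ r) :=
  ⟨(measurable_modeFun (Lp.stronglyMeasurable g)).aestronglyMeasurable, by
    rw [eLpNorm_modeFun hγ hp hl hpa m g]
    exact (Lp.memLp g).2⟩

theorem modeFun_congr {γ p a l : ℝ} {m : ℤ} {g h : ℝ → ℂ}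
    (hgh : g =ᵐ[volume.restrict (Set.Ioi (0 : ℝ))] h) (ζ : lerayHypersurface γ) :
    modeFun γ p a l m g ζ = modeFun γ p a l m h ζ := by
  unfold modeFun
  congr 1
  refine integral_congr_ae ?_
  filter_upwards [hgh] with ξ hξ
  simp [modeIntegrand, hξ]

/-- Off ζ₁ = 0 the factor e^{-lα^γ ξ} makes the frequency integrals converge; on the null set ζ₁ = 0
nothing ensures this. -/
theorem modeFun_add {γ p a l : ℝ} (hp : 0 < p) (hl : 0 < l) (m : ℤ) (g h : HalfLineL2)
    {ζ : lerayHypersurface γ} (hζ : ζ.1.1 ≠ 0) :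
    modeFun γ p a l m (g + h : HalfLineL2) ζ = modeFun γ p a l m g ζ + modeFun γ p a l m h ζ := by
  rw [modeFun_congr (Lp.coeFn_add g h)]
  have hα : 0 < ‖ζ.1.1‖ := norm_pos_iff.2 hζ
  unfold modeFun
  rw [← mul_add, ← integral_add (integrable_modeIntegrand hp hl hα _ (Lp.memLp g))
    (integrable_modeIntegrand hp hl hα _ (Lp.memLp h))]
  congr 2
  ext ξ
  simp only [modeIntegrand, Pi.add_apply]
  ring

theorem modeFun_smul {γ p a l : ℝ} (m : ℤ) (c : ℂ) (g : HalfLineL2) (ζ : lerayHypersurface γ) :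
    modeFun γ p a l m (c • g : HalfLineL2) ζ = c * modeFun γ p a l m g ζ := by
  rw [modeFun_congr (Lp.coeFn_smul c g)]
  unfold modeFun
  rw [mul_left_comm, ← integral_const_mul c]
  congr 2
  ext ξ
  simp only [modeIntegrand, Pi.smul_apply, smul_eq_mul]
  ring

/-- Taking a frequency profile to the corresponding mode is a linear isometry. -/
def modeIsometry {γ p a l r : ℝ} (hγ : 1 < γ) (hp : 0 < p) (hl : 0 < l)
    (hpa : γ * p = r + 2 * a + 1) (m : ℤ) : HalfLineL2 →ₗᵢ[ℂ] LerayL2 γ r where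
  toFun g := (memLp_modeFun hγ hp hl hpa m g).toLp _
  map_add' g h := by
    rw [← MemLp.toLp_add]
    refine MemLp.toLp_congr _ _ ?_
    filter_upwards [ae_lerayMeasure_ne_zero γ r] with ζ hζ
    exact modeFun_add hp hl m g h hζ
  map_smul' c g := by
    rw [RingHom.id_apply, ← MemLp.toLp_const_smul]
    refine MemLp.toLp_congr _ _ ?_
    filter_upwards with ζ
    exact modeFun_smul m c g ζ
  norm_map' g := by
    change ‖(memLp_modeFun hγ hp hl hpa m g).toLp _‖ = _
    rw [Lp.norm_toLp, eLpNorm_modeFun hγ hp hl hpa m g, Lp.norm_def]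

theorem modeIsometry_ae_eq {γ p a l r : ℝ} (hγ : 1 < γ) (hp : 0 < p) (hl : 0 < l)
    (hpa : γ * p = r + 2 * a + 1) (m : ℤ) (g : HalfLineL2) :
    modeIsometry hγ hp hl hpa m g =ᵐ[lerayMeasure γ r] modeFun γ p a l m g :=
  MemLp.coeFn_toLp (memLp_modeFun hγ hp hl hpa m g)

theorem integral_exp_zpow_eq_zero {k : ℤ} (hk : k ≠ 0) :
    ∫ θ in Set.Ico (0 : ℝ) (2 * Real.pi), Complex.exp (θ * Complex.I) ^ k = 0 := by
  rw [integral_Ico_eq_integral_Ioc, ← intervalIntegral.integral_of_le Real.two_pi_pos.le]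
  have hk' : (k : ℂ) * Complex.I ≠ 0 := by simp [hk]
  have h := integral_exp_mul_complex (a := 0) (b := 2 * Real.pi) hk'
  have e (θ : ℝ) : Complex.exp (θ * Complex.I) ^ k = Complex.exp (k * Complex.I * θ) := by
    rw [← Complex.exp_int_mul]
    ring_nf
  simp only [e, h]
  have : (k : ℂ) * Complex.I * ((2 * Real.pi : ℝ) : ℂ) = k * (2 * Real.pi * Complex.I) := by
    push_cast; ring
  rw [this, Complex.exp_int_mul_two_pi_mul_I]
  simp

/-- The θ-integral of e^{i(n-m)θ} already vanishes, so the radial parameters of the two modes may be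
unrelated. -/
theorem inner_modeIsometry_eq_zero {γ r : ℝ} (hγ : 1 < γ) {p a l p' a' l' : ℝ}
    (hp : 0 < p) (hl : 0 < l) (hpa : γ * p = r + 2 * a + 1)
    (hp' : 0 < p') (hl' : 0 < l') (hpa' : γ * p' = r + 2 * a' + 1) {m n : ℤ} (hmn : m ≠ n)
    (g h : HalfLineL2) :
    inner ℂ (modeIsometry hγ hp hl hpa m g) (modeIsometry hγ hp' hl' hpa' n h) = 0 := by
  set F : lerayHypersurface γ → ℂ := fun ζ =>
    modeFun γ p' a' l' n h ζ * conj (modeFun γ p a l m g ζ) with hF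
  have hi : Integrable F (lerayMeasure γ r) :=
    MemLp.integrable_mul (p := 2) (q := 2) (memLp_modeFun hγ hp' hl' hpa' n h)
      (memLp_modeFun hγ hp hl hpa m g).star
  have e : inner ℂ (modeIsometry hγ hp hl hpa m g) (modeIsometry hγ hp' hl' hpa' n h) =
      ∫ ζ, F ζ ∂lerayMeasure γ r := by
    rw [L2.inner_def]
    refine integral_congr_ae ?_
    filter_upwards [modeIsometry_ae_eq hγ hp hl hpa m g,
      modeIsometry_ae_eq hγ hp' hl' hpa' n h] with ζ h1 h2
    rw [h1, h2]
    rfl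
  rw [e]
  unfold lerayMeasure at hi ⊢
  have hm := hi.1
  rw [integrable_map_measure hi.1 (measurable_lerayParam γ).aemeasurable] at hi
  rw [integral_map (measurable_lerayParam γ).aemeasurable hm]
  have hi' : Integrable (fun q => F (lerayParam γ q)) _ := hi
  rw [integral_prod _ hi']
  refine integral_eq_zero_of_ae ?_
  have hae : ∀ᵐ α ∂((volume.restrict (Set.Ioi (0 : ℝ))).withDensity
      fun α => ENNReal.ofReal (α ^ r)), α ∈ Set.Ioi (0 : ℝ) :=
    (withDensity_absolutelyContinuous _ _).ae_le (ae_restrict_mem measurableSet_Ioi)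
  filter_upwards [hae] with α hα
  have hα : 0 < α := hα
  have e2 (q : ℝ × ℝ) : F (lerayParam γ (α, q)) =
      Complex.exp (q.1 * Complex.I) ^ (n - m) * (((α ^ a' : ℝ) : ℂ) *
        (∫ ξ in Set.Ioi (0 : ℝ), modeIntegrand γ p' l' h α q.2 ξ) * conj (((α ^ a : ℝ) : ℂ) *
        (∫ ξ in Set.Ioi (0 : ℝ), modeIntegrand γ p l g α q.2 ξ))) := by
    simp only [hF]
    rw [modeFun_lerayParam hα, modeFun_lerayParam hα, zpow_sub₀ (Complex.exp_ne_zero _)]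
    have : conj (Complex.exp (q.1 * Complex.I) ^ m) = (Complex.exp (q.1 * Complex.I) ^ m)⁻¹ := by
      rw [map_zpow₀, ← Complex.exp_conj, ← inv_zpow, ← Complex.exp_neg]
      simp
    simp only [map_mul, this]
    ring
  simp only [e2]
  rw [integral_prod_mul (f := fun θ : ℝ => Complex.exp (θ * Complex.I) ^ (n - m))
    (g := fun s : ℝ => (((α ^ a' : ℝ) : ℂ) *
        (∫ ξ in Set.Ioi (0 : ℝ), modeIntegrand γ p' l' h α s ξ) * conj (((α ^ a : ℝ) : ℂ) *
        (∫ ξ in Set.Ioi (0 : ℝ), modeIntegrand γ p l g α s ξ)))),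
    integral_exp_zpow_eq_zero (sub_ne_zero.2 hmn.symm), zero_mul]
  rfl

/-! ### Boundedness of the symbol by Stirling's formula. -/

/-- The Stirling sequence decreases, so its first term e/√2 bounds it. -/
theorem factorial_le_stirling {n : ℕ} (hn : n ≠ 0) :
    (n.factorial : ℝ) ≤ Real.exp 1 * √n * (n / Real.exp 1) ^ n := by
  obtain ⟨m, rfl⟩ := Nat.exists_eq_succ_of_ne_zero hn
  have h : Stirling.stirlingSeq (m + 1) ≤ Stirling.stirlingSeq 1 :=
    Stirling.stirlingSeq'_antitone (Nat.zero_le m)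
  rw [Stirling.stirlingSeq_one, Stirling.stirlingSeq, div_le_iff₀ (by positivity)] at h
  refine h.trans (le_of_eq ?_)
  rw [Real.sqrt_mul (by norm_num)]
  field_simp

/-- Stirling's upper bound for the Gamma function, up to a constant. -/
theorem Real.Gamma_le_stirling {x : ℝ} (hx : 1 ≤ x) :
    Real.Gamma x ≤ Real.exp 2 * (x ^ x * Real.exp (-x) / √x) := by
  set n := ⌊x⌋₊ with hn
  have hn1 : 1 ≤ n := Nat.le_floor (by exact_mod_cast hx)
  have hnx : (n : ℝ) ≤ x := Nat.floor_le (by linarith)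
  have hxn : x < n + 1 := Nat.lt_floor_add_one x
  have hn0 : (0 : ℝ) < n := by exact_mod_cast hn1
  have hfac : Real.Gamma n = n.factorial / n := by
    rw [← Real.Gamma_nat_eq_factorial, Real.Gamma_add_one hn0.ne']
    field_simp
  have hGn := Real.Gamma_pos_of_pos hn0
  have h1 : Real.Gamma x ≤ Real.Gamma n * (n : ℝ) ^ (x - n) := by
    rcases hnx.eq_or_lt with h | h
    · rw [← h]; simp
    -- Log-convexity of Gamma between n and n + 1, with x as the convex combination of weights n + 1
    -- - x and x - n.
    have := Real.Gamma_mul_add_mul_le_rpow_Gamma_mul_rpow_Gamma hn0 (by linarith : (0 : ℝ) < n + 1)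
      (a := n + 1 - x) (b := x - n) (by linarith) (by linarith) (by ring)
    rw [Real.Gamma_add_one hn0.ne', Real.mul_rpow hn0.le hGn.le,
      mul_left_comm, ← Real.rpow_add hGn] at this
    ring_nf at this ⊢
    simpa [mul_comm] using this
  calc Real.Gamma x ≤ Real.Gamma n * (n : ℝ) ^ (x - n) := h1
    _ ≤ Real.exp 1 * √n * (n / Real.exp 1) ^ n / n * (n : ℝ) ^ (x - n) := by
        rw [hfac]
        gcongr
        exact factorial_le_stirling (by omega)
    _ = Real.exp 1 * ((n : ℝ) ^ (x - 1 / 2) * Real.exp (-n)) := by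
        rw [show x - 1 / 2 = 1 / 2 + n - 1 + (x - n) by ring, Real.rpow_add hn0,
          Real.rpow_sub_one hn0.ne', Real.rpow_add hn0, Real.rpow_natCast, div_pow,
          ← Real.exp_nat_mul, Real.exp_neg, Real.sqrt_eq_rpow]
        field_simp
    _ ≤ Real.exp 1 * (x ^ (x - 1 / 2) * Real.exp (1 - x)) := by
        gcongr <;> linarith
    _ = _ := by
        rw [Real.rpow_sub (by linarith), ← Real.sqrt_eq_rpow, show (2 : ℝ) = 1 + 1 by norm_num,
          Real.exp_add, Real.exp_sub, Real.exp_neg]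
        field_simp

theorem rpow_self_le {x M t : ℝ} (hx : 0 < x) (hM : 0 < M) (h : x ≤ M * Real.exp t) :
    x ^ x ≤ M ^ x * Real.exp (t * x) := by
  rw [Real.exp_mul, ← Real.mul_rpow hM.le (Real.exp_pos t).le]
  exact Real.rpow_le_rpow hx.le h hx.le

theorem factorial_sq_ge (k : ℕ) :
    2 * Real.pi * ((k : ℝ) + 1) ^ (2 * k + 2) * Real.exp (-(2 * k + 2)) / (k + 1) ≤
      Real.Gamma (k + 1) ^ 2 := by
  have h := Stirling.le_factorial_stirling (k + 1)
  have hk : (0 : ℝ) < k + 1 := by positivity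
  rw [Nat.factorial_succ] at h
  push_cast at h
  rw [Real.Gamma_nat_eq_factorial]
  have h2 := pow_le_pow_left₀ (by positivity) h 2
  rw [mul_pow, Real.sq_sqrt (by positivity), div_pow, ← Real.exp_nat_mul, div_pow, ← pow_mul,
    ← Real.exp_nat_mul] at h2
  rw [Real.exp_neg, div_le_iff₀ hk]
  refine le_of_mul_le_mul_right ?_ hk
  convert! h2 using 1
  · push_cast
    rw [show (2 : ℝ) * ((k + 1) * 1) = 2 * k + 2 by ring, show (k + 1) * 2 = 2 * k + 2 by ring]
    field_simp
  · ring

/-- The two bounds on r are exactly the positivity of the two Gamma arguments at k = 0, the worst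
case. -/
theorem leraySymbol_pos {γ r : ℝ} (hγ : 1 < γ) (hr : r ∈ Set.Ioo (-1) (2 * γ - 1)) (k : ℕ) :
    0 < leraySymbol γ r k := by
  obtain ⟨h1, h2⟩ := hr
  have hk : (0 : ℝ) ≤ k := by positivity
  have h3 : 0 < (2 * k + 1 + r) / γ := div_pos (by linarith) (by linarith)
  have h4 : 0 < 2 * k + 2 - (2 * k + 1 + r) / γ := by
    rw [sub_pos, div_lt_iff₀ (by linarith)]
    nlinarith
  have := Real.Gamma_pos_of_pos h3
  have := Real.Gamma_pos_of_pos h4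
  have := Real.Gamma_pos_of_pos (by positivity : (0 : ℝ) < k + 1)
  have : 0 < γ - 1 := by linarith
  unfold leraySymbol
  positivity

/-- The Gamma arguments x, y sum to N = 2k + 2 and are close to N/γ and (γ-1)N/γ. After Stirling,
(N/γ)^N (γ/2)^N cancels (k+1)^N from the factorial, (γ-1)^y cancels (γ-1)^{-y}, and 1/√(xy) cancels
the factor k + 1. The hypotheses give, in order, x ≥ N/(2γ), y ≥ (γ-1)N/(2γ), x ≥ 1 and y ≥ 1. -/
theorem leraySymbol_le_of_large {γ r : ℝ} (hγ : 1 < γ) {k : ℕ}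
    (h1 : -2 * (r - 1) ≤ 2 * k + 2) (h2 : 2 * (r - 1) / (γ - 1) ≤ 2 * k + 2)
    (h3 : γ - (r - 1) ≤ 2 * k + 2) (h4 : (γ + (r - 1)) / (γ - 1) ≤ 2 * k + 2) :
    leraySymbol γ r k ≤ Real.exp (4 + (|r - 1| + |r - 1| / (γ - 1))) * γ /
      (2 * Real.pi * √(γ - 1)) := by
  have hg : 0 < γ - 1 := by linarith
  have hg0 : 0 < γ := by linarith
  have hpi := Real.pi_pos
  rw [div_le_iff₀ hg] at h2 h4
  set N : ℝ := 2 * k + 2 with hN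
  have hN0 : 0 < N := by positivity
  set c := r - 1 with hc
  set x := (2 * k + 1 + r) / γ with hx
  set y := N - x with hy
  have hxN : x = (N + c) / γ := by rw [hx, hN, hc]; ring
  have hyN : y = ((γ - 1) * N - c) / γ := by rw [hy, hxN]; field_simp; ring
  have hx1 : 1 ≤ x := by rw [hxN, le_div_iff₀ hg0]; linarith
  have hy1 : 1 ≤ y := by rw [hyN, le_div_iff₀ hg0]; linarith
  have hx2 : N / (2 * γ) ≤ x := by
    rw [hxN, div_le_div_iff₀ (by positivity) hg0]; nlinarith
  have hy2 : (γ - 1) * N / (2 * γ) ≤ y := by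
    rw [hyN, div_le_div_iff₀ (by positivity) hg0]; nlinarith
  -- Since x = (N/γ)(1 + c/N) ≤ (N/γ) e^{c/N}, replacing the base x by N/γ costs at most e^{|c|};
  -- likewise for y.
  have hxx : x ^ x ≤ (N / γ) ^ x * Real.exp (|c|) := by
    refine (rpow_self_le (by linarith) (by positivity : 0 < N / γ) (t := c / N) ?_).trans ?_
    · have := Real.add_one_le_exp (c / N)
      calc x = N / γ * (c / N + 1) := by rw [hxN]; field_simp; ring
        _ ≤ _ := by gcongr
    · gcongr
      calc c / N * x ≤ |c| / N * N := by
            gcongr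
            · exact le_abs_self c
            · linarith
        _ = |c| := by field_simp
  have hyy : y ^ y ≤ ((γ - 1) * N / γ) ^ y * Real.exp (|c| / (γ - 1)) := by
    refine (rpow_self_le (by linarith) (by positivity : 0 < (γ - 1) * N / γ)
      (t := -c / ((γ - 1) * N)) ?_).trans ?_
    · have := Real.add_one_le_exp (-c / ((γ - 1) * N))
      calc y = (γ - 1) * N / γ * (-c / ((γ - 1) * N) + 1) := by rw [hyN]; field_simp; ring
        _ ≤ _ := by gcongr
    · gcongr
      calc -c / ((γ - 1) * N) * y ≤ |c| / ((γ - 1) * N) * N := by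
            gcongr
            · exact neg_le_abs c
            · linarith
        _ = |c| / (γ - 1) := by field_simp
  have hsq : N * √(γ - 1) / (2 * γ) ≤ √x * √y := by
    rw [← Real.sqrt_mul (by linarith)]
    apply Real.le_sqrt_of_sq_le
    calc (N * √(γ - 1) / (2 * γ)) ^ 2 = N / (2 * γ) * ((γ - 1) * N / (2 * γ)) := by
          rw [div_pow, mul_pow, Real.sq_sqrt hg.le]; field_simp
      _ ≤ x * y := by gcongr
  have hxy : x + y = N := by rw [hy]; ring
  have hGk := Real.Gamma_pos_of_pos (by positivity : (0 : ℝ) < k + 1)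
  have hsx : 0 < √x := Real.sqrt_pos.2 (by linarith)
  have hsy : 0 < √y := Real.sqrt_pos.2 (by linarith)
  have hpow : (γ / 2) ^ (2 * k + 2) = (γ / 2) ^ N := by
    rw [hN, ← Real.rpow_natCast]; push_cast; rfl
  have hGG : Real.Gamma x * Real.Gamma y ≤ Real.exp (4 + (|c| + |c| / (γ - 1))) *
      ((N / γ) ^ N * (γ - 1) ^ y * Real.exp (-N)) / (N * √(γ - 1) / (2 * γ)) := by
    calc Real.Gamma x * Real.Gamma y
        ≤ (Real.exp 2 * (x ^ x * Real.exp (-x) / √x)) *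
          (Real.exp 2 * (y ^ y * Real.exp (-y) / √y)) := by
          refine mul_le_mul (Real.Gamma_le_stirling hx1) (Real.Gamma_le_stirling hy1) ?_
            (by positivity)
          exact (Real.Gamma_pos_of_pos (by linarith)).le
      _ = Real.exp 2 * Real.exp 2 * (x ^ x * y ^ y * (Real.exp (-x) * Real.exp (-y))) /
          (√x * √y) := by field_simp
      _ ≤ Real.exp 2 * Real.exp 2 * (((N / γ) ^ x * Real.exp (|c|)) *
          (((γ - 1) * N / γ) ^ y * Real.exp (|c| / (γ - 1))) *
          (Real.exp (-x) * Real.exp (-y))) / (N * √(γ - 1) / (2 * γ)) := by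
          gcongr
      _ = _ := by
          rw [← Real.exp_add (-x), show -x + -y = -N by linarith, mul_div_assoc (γ - 1),
            Real.mul_rpow hg.le (by positivity), ← hxy, Real.rpow_add (by positivity),
            Real.exp_add 4, Real.exp_add (|c|), show (4 : ℝ) = 2 + 2 by norm_num, Real.exp_add 2]
          ring
  calc leraySymbol γ r k = Real.Gamma x * Real.Gamma y / Real.Gamma (k + 1) ^ 2 * (γ / 2) ^ N *
        (γ - 1) ^ (-y) := by rw [← hpow]; rfl
    _ ≤ (Real.exp (4 + (|c| + |c| / (γ - 1))) *
      ((N / γ) ^ N * (γ - 1) ^ y * Real.exp (-N)) / (N * √(γ - 1) / (2 * γ))) /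
        (2 * Real.pi * ((k : ℝ) + 1) ^ (2 * k + 2) * Real.exp (-(2 * k + 2)) / (k + 1)) *
        (γ / 2) ^ N * (γ - 1) ^ (-y) := by
        gcongr
        exact factorial_sq_ge k
    _ = _ := by
        have e1 : ((k : ℝ) + 1) ^ (2 * k + 2) = (N / γ) ^ N * (γ / 2) ^ N := by
          rw [← Real.mul_rpow (by positivity) (by positivity),
            show N / γ * (γ / 2) = k + 1 by rw [hN]; field_simp, hN, ← Real.rpow_natCast]
          push_cast
          rfl
        have e2 : (k : ℝ) + 1 = N / 2 := by rw [hN]; ring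
        have := Real.rpow_pos_of_pos (by positivity : 0 < N / γ) N
        have := Real.rpow_pos_of_pos (by positivity : 0 < γ / 2) N
        have := Real.rpow_pos_of_pos hg y
        rw [e1, e2, ← hN, Real.rpow_neg hg.le]
        field_simp

theorem exists_leraySymbol_le {γ : ℝ} (hγ : 1 < γ) (r : ℝ) :
    ∃ C : ℝ, ∀ k, leraySymbol γ r k ≤ C := by
  obtain ⟨K, hK⟩ := exists_nat_ge (max (max (-2 * (r - 1)) (2 * (r - 1) / (γ - 1)))
    (max (γ - (r - 1)) ((γ + (r - 1)) / (γ - 1))))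
  simp only [max_le_iff] at hK
  have hb : BddAbove (Set.range (leraySymbol γ r)) := by
    refine (Filter.isBoundedUnder_of_eventually_le (a := Real.exp (4 + (|r - 1| + |r - 1| /
      (γ - 1))) * γ / (2 * Real.pi * √(γ - 1))) ?_).bddAbove_range
    filter_upwards [Filter.eventually_ge_atTop K] with k hk
    have hk' : (K : ℝ) ≤ k := by exact_mod_cast hk
    have : (0 : ℝ) ≤ k := by positivity
    exact leraySymbol_le_of_large hγ (by linarith) (by linarith) (by linarith) (by linarith)
  obtain ⟨C, hC⟩ := hb
  exact ⟨C, fun k => hC ⟨k, rfl⟩⟩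

/-! ### Diagonal operators and their spectra. -/

section Diagonal

variable {ι E : Type*} [NormedAddCommGroup E] [InnerProductSpace ℂ E]

theorem memℓp_diagonal {T : ι → E →L[ℂ] E} {C : ℝ} (hT : ∀ i, ‖T i‖ ≤ C)
    (f : lp (fun _ : ι => E) 2) : Memℓp (fun i => T i (f i)) 2 := by
  have h := (lp.memℓp f).summable (by norm_num)
  refine memℓp_gen (Summable.of_nonneg_of_le (fun i => by positivity) (fun i => ?_)
    (h.mul_left (C ^ (2 : ℝ≥0∞).toReal)))
  have hC : 0 ≤ C := (norm_nonneg _).trans (hT i)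
  rw [← Real.mul_rpow hC (norm_nonneg _)]
  gcongr
  exact (T i).le_of_opNorm_le (hT i) _

/-- The block diagonal operator on an `ℓ²` direct sum with a bounded family of diagonal blocks. -/
def lp.diagonal (T : ι → E →L[ℂ] E) (C : ℝ) (hT : ∀ i, ‖T i‖ ≤ C) :
    lp (fun _ : ι => E) 2 →L[ℂ] lp (fun _ : ι => E) 2 :=
  LinearMap.mkContinuous
    { toFun := fun f => ⟨fun i => T i (f i), memℓp_diagonal hT f⟩
      map_add' := fun f g => by ext i; simp; rfl
      -- For an empty index type C may be negative, hence the absolute value.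
      map_smul' := fun c f => by ext i; simp } |C| fun f => by
    refine lp.norm_le_of_forall_sum_le (by norm_num) (by positivity) fun s => ?_
    rw [Real.mul_rpow (abs_nonneg C) (norm_nonneg f)]
    refine le_trans (Finset.sum_le_sum (g := fun i => |C| ^ (2 : ℝ≥0∞).toReal *
      ‖f i‖ ^ (2 : ℝ≥0∞).toReal) fun i _ => ?_) ?_
    · rw [← Real.mul_rpow (abs_nonneg C) (norm_nonneg _)]
      gcongr
      exact (T i).le_of_opNorm_le ((hT i).trans (le_abs_self C)) _
    · rw [← Finset.mul_sum]
      gcongr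
      exact lp.sum_rpow_le_norm_rpow (by norm_num) f s

@[simp]
theorem lp.diagonal_apply (T : ι → E →L[ℂ] E) (C : ℝ) (hT : ∀ i, ‖T i‖ ≤ C)
    (f : lp (fun _ : ι => E) 2) (i : ι) : lp.diagonal T C hT f i = T i (f i) := rfl

end Diagonal

section DiagonalSpectrum

variable {ι H : Type*} [NormedAddCommGroup H] [InnerProductSpace ℂ H]
  {b : HilbertBasis ι ℂ H} {T : H →L[ℂ] H} {c : ι → ℂ}

/-- The functionals ⟨b i, T ·⟩ and c i ⟨b i, ·⟩ are continuous and agree on the basis, whose span is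
dense. -/
theorem HilbertBasis.repr_apply_of_eigenbasis (hT : ∀ i, T (b i) = c i • b i) (v : H) (i : ι) :
    b.repr (T v) i = c i * b.repr v i := by
  classical
  have h : (innerSL ℂ (b i)).comp T = c i • innerSL ℂ (b i) := by
    refine ContinuousLinearMap.ext_on
      (Submodule.dense_iff_topologicalClosure_eq_top.2 b.dense_span) ?_
    rintro _ ⟨j, rfl⟩
    have ho := orthonormal_iff_ite.1 b.orthonormal i j
    by_cases hij : i = j
    · subst hij
      simp [hT]
    · simp [hT, ho, hij]
  rw [b.repr_apply_apply, b.repr_apply_apply]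
  exact congrArg (fun S => S v) h

theorem hasEigenvector_of_eigenbasis (hT : ∀ i, T (b i) = c i • b i) (i : ι) :
    Module.End.HasEigenvector (T : H →ₗ[ℂ] H) (c i) (b i) :=
  ⟨Module.End.mem_eigenspace_iff.2 (hT i), b.orthonormal.ne_zero i⟩

theorem hasEigenvalue_iff_of_eigenbasis (hT : ∀ i, T (b i) = c i • b i) (z : ℂ) :
    Module.End.HasEigenvalue (T : H →ₗ[ℂ] H) z ↔ z ∈ Set.range c := by
  constructor
  · intro h
    obtain ⟨v, hv, hv0⟩ := h.exists_hasEigenvector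
    have hv : T v = z • v := Module.End.mem_eigenspace_iff.1 hv
    by_contra hz
    refine hv0 (b.repr.map_eq_zero_iff.1 ?_)
    ext i
    have h1 := HilbertBasis.repr_apply_of_eigenbasis hT v i
    rw [hv, map_smul] at h1
    have h2 : (z - c i) * b.repr v i = 0 := by
      rw [sub_mul, ← h1]
      simp
    rcases mul_eq_zero.1 h2 with h3 | h3
    · exact (hz ⟨i, (sub_eq_zero.1 h3).symm⟩).elim
    · simpa using h3
  · rintro ⟨i, rfl⟩
    exact Module.End.hasEigenvalue_of_hasEigenvector (hasEigenvector_of_eigenbasis hT i)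

/-- At distance δ > 0 from the eigenvalues, the diagonal operator with entries (z - c i)⁻¹ is
bounded by δ⁻¹ and inverts z - T. Conversely eigenvalues lie in the spectrum, which is closed. -/
theorem spectrum_of_eigenbasis [CompleteSpace H] (hT : ∀ i, T (b i) = c i • b i) :
    spectrum ℂ T = closure (Set.range c) := by
  classical
  refine subset_antisymm ?_ (closure_minimal ?_ (spectrum.isClosed T))
  · intro z hz
    by_contra hz'
    obtain ⟨δ, hδ, hball⟩ := Metric.mem_nhds_iff.1 (isClosed_closure.isOpen_compl.mem_nhds hz')
    have hdist (i : ι) : δ ≤ ‖z - c i‖ := by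
      by_contra! hlt
      exact hball (a := c i) (by rwa [Metric.mem_ball, dist_comm, dist_eq_norm])
        (subset_closure ⟨i, rfl⟩)
    have hne (i : ι) : z - c i ≠ 0 := norm_pos_iff.1 (hδ.trans_le (hdist i))
    let D := lp.diagonal (fun i => (z - c i)⁻¹ • ContinuousLinearMap.id ℂ ℂ) δ⁻¹ fun i => by
      rw [norm_smul, norm_inv, ContinuousLinearMap.norm_id, mul_one]
      exact inv_anti₀ hδ (hdist i)
    let R : H →L[ℂ] H := (b.repr.symm : lp (fun _ : ι => ℂ) 2 →L[ℂ] H).comp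
      (D.comp (b.repr : H →L[ℂ] lp (fun _ : ι => ℂ) 2))
    have hR (v : H) (i : ι) : b.repr (R v) i = (z - c i)⁻¹ * b.repr v i := by
      simp [R, D]
    have hS (v : H) (i : ι) : b.repr ((algebraMap ℂ (H →L[ℂ] H) z - T) v) i =
        (z - c i) * b.repr v i := by
      rw [sub_apply, map_sub, lp.coeFn_sub, Pi.sub_apply,
        HilbertBasis.repr_apply_of_eigenbasis hT, sub_mul]
      simp [Algebra.algebraMap_eq_smul_one]
    refine hz ?_
    refine ⟨⟨algebraMap ℂ (H →L[ℂ] H) z - T, R, ?_, ?_⟩, rfl⟩ <;>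
    · ext v
      refine b.repr.injective ?_
      ext i
      rw [mul_apply_eq_comp]
      simp only [hR, hS]
      rw [← mul_assoc]
      simp [hne i]
  · rintro _ ⟨i, rfl⟩ hu
    have hu : IsUnit (algebraMap ℂ (H →L[ℂ] H) (c i) - T) := hu
    obtain ⟨u, hu⟩ := hu
    refine b.orthonormal.ne_zero i ?_
    have h1 : (u : H →L[ℂ] H) (b i) = 0 := by
      rw [hu]
      simp [Algebra.algebraMap_eq_smul_one, hT]
    calc b i = ((u⁻¹ : (H →L[ℂ] H)ˣ) : H →L[ℂ] H) ((u : H →L[ℂ] H) (b i)) := by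
          rw [← mul_apply_eq_comp, Units.inv_mul]; rfl
      _ = 0 := by rw [h1, map_zero]

end DiagonalSpectrum

/-! ### Weighted sums of partial isometries. -/

section PartialIsometries

variable {H K : Type} [NormedAddCommGroup H] [InnerProductSpace ℂ H] [CompleteSpace H]
  [NormedAddCommGroup K] [InnerProductSpace ℂ K] [CompleteSpace K]

/-- The images of a Hilbert basis of K under all `V k` are orthonormal; extend them to a Hilbert
basis of H. The added vectors are orthogonal to every range, so T kills them. `hV0` forces at least
one added vector, and nontriviality of K makes every `c k` occur. -/
theorem exists_eigenbasis [Nontrivial K] {V : ℕ → K →ₗᵢ[ℂ] H}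
    (hV : OrthogonalFamily ℂ (fun _ : ℕ => K) V) {T : H →L[ℂ] H} {c : ℕ → ℂ}
    (hT : ∀ k g, T (V k g) = c k • V k g)
    (hT0 : ∀ v, (∀ k g, inner ℂ (V k g) v = 0) → T v = 0)
    (hV0 : ∃ v ≠ 0, ∀ k g, inner ℂ (V k g) v = 0) :
    ∃ (ι : Type) (b : HilbertBasis ι ℂ H) (d : ι → ℂ),
      (∀ i, T (b i) = d i • b i) ∧ Set.range d = {0} ∪ Set.range c := by
  obtain ⟨w, e, -⟩ := exists_hilbertBasis ℂ K
  have hw : Nonempty w := by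
    by_contra hw
    rw [not_nonempty_iff] at hw
    obtain ⟨x, hx⟩ := exists_ne (0 : K)
    refine hx (e.repr.map_eq_zero_iff.1 ?_)
    ext i
    exact hw.elim i
  set S : Set H := Set.range fun q : ℕ × w => V q.1 (e q.2) with hS
  have hSo : Orthonormal ℂ ((↑) : S → H) := by
    refine Orthonormal.toSubtypeRange (v := fun q : ℕ × w => V q.1 (e q.2)) ?_
    constructor
    · intro q
      simp [e.orthonormal.1]
    · rintro ⟨k, i⟩ ⟨l, j⟩ hne
      by_cases hkl : k = l
      · subst hkl
        have hij : i ≠ j := fun h => hne (by rw [h])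
        simpa using e.orthonormal.2 hij
      · exact hV hkl _ _
  -- Orthogonality to the images of the basis of K says that all coordinates of the adjoint of `V k`
  -- at v vanish.
  have hperp {v : H} (hv : ∀ s ∈ S, inner ℂ s v = 0) (k : ℕ) (g : K) :
      inner ℂ (V k g) v = 0 := by
    have h : (ContinuousLinearMap.adjoint (V k).toContinuousLinearMap) v = 0 := by
      refine e.repr.map_eq_zero_iff.1 ?_
      ext i
      rw [e.repr_apply_apply, ContinuousLinearMap.adjoint_inner_right]
      exact hv _ ⟨(k, i), rfl⟩
    have := ContinuousLinearMap.adjoint_inner_right (V k).toContinuousLinearMap g v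
    rw [h, inner_zero_right] at this
    exact this.symm
  obtain ⟨B, b, hSB, hb⟩ := hSo.exists_hilbertBasis_extension
  have hbi (i : B) : b i = (i : H) := congrFun hb i
  have hno (i : B) (hi : (i : H) ∉ S) : T (b i) = 0 := by
    refine hT0 _ (hperp fun s hs => ?_)
    have : inner ℂ (b ⟨s, hSB hs⟩) (b i) = 0 :=
      b.orthonormal.2 (fun h => hi (by rw [← h]; exact hs))
    rwa [hbi ⟨s, hSB hs⟩] at this
  have hd (i : B) : ∃ z ∈ {0} ∪ Set.range c, T (b i) = z • b i := by
    by_cases hi : (i : H) ∈ S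
    · obtain ⟨⟨k, j⟩, hkj⟩ := hi
      refine ⟨c k, Or.inr ⟨k, rfl⟩, ?_⟩
      rw [hbi, ← hkj]
      exact hT k _
    · exact ⟨0, Or.inl rfl, by rw [hno i hi, zero_smul]⟩
  choose d hd1 hd2 using hd
  refine ⟨B, b, d, hd2, subset_antisymm (Set.range_subset_iff.2 hd1) ?_⟩
  rintro z (rfl | ⟨k, rfl⟩)
  · obtain ⟨v, hv0, hv⟩ := hV0
    have : ∃ i : B, (i : H) ∉ S := by
      by_contra! hall
      refine hv0 (b.repr.map_eq_zero_iff.1 ?_)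
      ext i
      obtain ⟨⟨k, j⟩, hkj⟩ := hall i
      rw [b.repr_apply_apply, hbi, ← hkj]
      exact hv _ _
    obtain ⟨i, hi⟩ := this
    refine ⟨i, ?_⟩
    have := hd2 i
    rw [hno i hi] at this
    exact (smul_eq_zero.1 this.symm).resolve_right (b.orthonormal.ne_zero i)
  · obtain ⟨j⟩ := hw
    have hmem : V k (e j) ∈ S := ⟨(k, j), rfl⟩
    refine ⟨⟨_, hSB hmem⟩, ?_⟩
    have h1 := hd2 ⟨_, hSB hmem⟩
    have h2 := b.orthonormal.ne_zero ⟨_, hSB hmem⟩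
    rw [hbi] at h1 h2
    rw [hT] at h1
    exact (smul_left_injective ℂ h2 h1).symm

/-- The operator `V ∘ D ∘ W*`, where the isometries `V` and `W` of the `ℓ²` direct sum are given by
orthogonal families of isometries. -/
def weightedSum {V W : ℕ → K →ₗᵢ[ℂ] H} (hV : OrthogonalFamily ℂ (fun _ : ℕ => K) V)
    (hW : OrthogonalFamily ℂ (fun _ : ℕ => K) W)
    (D : lp (fun _ : ℕ => K) 2 →L[ℂ] lp (fun _ : ℕ => K) 2) : H →L[ℂ] H :=
  hV.linearIsometry.toContinuousLinearMap.comp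
    (D.comp (ContinuousLinearMap.adjoint hW.linearIsometry.toContinuousLinearMap))

theorem adjoint_linearIsometry_eq_zero {W : ℕ → K →ₗᵢ[ℂ] H}
    (hW : OrthogonalFamily ℂ (fun _ : ℕ => K) W) {v : H} (hv : ∀ k g, inner ℂ (W k g) v = 0) :
    ContinuousLinearMap.adjoint hW.linearIsometry.toContinuousLinearMap v = 0 := by
  refine ext_inner_left ℂ fun f => ?_
  rw [ContinuousLinearMap.adjoint_inner_right, inner_zero_right]
  have h := (hW.hasSum_linearIsometry f).mapL (innerSLFlip ℂ v)
  refine h.unique ?_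
  simp [hv]

theorem adjoint_linearIsometry_apply {W : ℕ → K →ₗᵢ[ℂ] H}
    (hW : OrthogonalFamily ℂ (fun _ : ℕ => K) W) (f : lp (fun _ : ℕ => K) 2) :
    ContinuousLinearMap.adjoint hW.linearIsometry.toContinuousLinearMap (hW.linearIsometry f) =
      f := by
  refine ext_inner_left ℂ fun g => ?_
  rw [ContinuousLinearMap.adjoint_inner_right]
  exact hW.linearIsometry.inner_map_map g f

theorem weightedSum_adjoint {V W : ℕ → K →ₗᵢ[ℂ] H} (hV : OrthogonalFamily ℂ (fun _ : ℕ => K) V)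
    (hW : OrthogonalFamily ℂ (fun _ : ℕ => K) W)
    {D : lp (fun _ : ℕ => K) 2 →L[ℂ] lp (fun _ : ℕ => K) 2} (hD : IsSelfAdjoint D) :
    ContinuousLinearMap.adjoint (weightedSum hV hW D) = weightedSum hW hV D := by
  unfold weightedSum
  rw [ContinuousLinearMap.adjoint_comp, ContinuousLinearMap.adjoint_comp,
    ContinuousLinearMap.adjoint_adjoint, ContinuousLinearMap.isSelfAdjoint_iff'.1 hD]
  rfl

theorem isSelfAdjoint_diagonal (a : ℕ → ℝ) (C : ℝ)
    (ha : ∀ k, ‖(a k : ℂ) • ContinuousLinearMap.id ℂ K‖ ≤ C) :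
    IsSelfAdjoint (lp.diagonal (fun k => (a k : ℂ) • ContinuousLinearMap.id ℂ K) C ha) := by
  rw [ContinuousLinearMap.isSelfAdjoint_iff', eq_comm, ContinuousLinearMap.eq_adjoint_iff]
  intro f g
  rw [lp.inner_eq_tsum, lp.inner_eq_tsum]
  congr 1 with k
  simp [-Complex.coe_smul, inner_smul_left, inner_smul_right]

/-- Since V*V = 1, the product W D V* V D W* collapses to W D² W*. -/
theorem exists_eigenbasis_weightedSum [Nontrivial K] {V W : ℕ → K →ₗᵢ[ℂ] H}
    (hV : OrthogonalFamily ℂ (fun _ : ℕ => K) V) (hW : OrthogonalFamily ℂ (fun _ : ℕ => K) W)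
    (hW0 : ∃ v ≠ 0, ∀ k g, inner ℂ (W k g) v = 0) {a : ℕ → ℝ} {C : ℝ}
    (ha : ∀ k, ‖(a k : ℂ) • ContinuousLinearMap.id ℂ K‖ ≤ C)
    {D : lp (fun _ : ℕ => K) 2 →L[ℂ] lp (fun _ : ℕ => K) 2}
    (hD : D = lp.diagonal (fun k => (a k : ℂ) • ContinuousLinearMap.id ℂ K) C ha) :
    ∃ (ι : Type) (b : HilbertBasis ι ℂ H) (d : ι → ℂ),
      (∀ i, (weightedSum hW hV D).comp (weightedSum hV hW D) (b i) = d i • b i) ∧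
        Set.range d = {0} ∪ Set.range fun k => ((a k ^ 2 : ℝ) : ℂ) := by
  classical
  refine exists_eigenbasis hW (fun k g => ?_) (fun v hv => ?_) hW0
  · have h1 : W k g = hW.linearIsometry (lp.single 2 k g) :=
      (hW.linearIsometry_apply_single g).symm
    have h2 : D (D (lp.single 2 k g)) = ((a k ^ 2 : ℝ) : ℂ) • lp.single 2 k g := by
      ext j
      by_cases hj : j = k
      · subst hj
        simp [-Complex.coe_smul, hD, smul_smul, sq]
      · simp [hD, hj]
    rw [h1, ContinuousLinearMap.comp_apply]
    simp only [weightedSum, ContinuousLinearMap.comp_apply, LinearIsometry.coe_toContinuousLinearMap,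
      adjoint_linearIsometry_apply, h2, map_smul]
  · simp only [weightedSum, ContinuousLinearMap.comp_apply, adjoint_linearIsometry_eq_zero hW hv,
      map_zero]

end PartialIsometries

/-! ### L² sums, pointwise sums and frequency damping. -/

/-- A subsequence of the L²-convergent partial sums converges almost everywhere, and its limit must
be the pointwise sum. -/
theorem Lp_ae_eq_of_hasSum {X : Type*} {mX : MeasurableSpace X} {μ : Measure X}
    {u : ℕ → Lp ℂ 2 μ} {U : Lp ℂ 2 μ} (hU : HasSum u U) {v : ℕ → X → ℂ}
    (huv : ∀ k, u k =ᵐ[μ] v k) {G : X → ℂ} (hG : ∀ᵐ x ∂μ, HasSum (fun k => v k x) (G x)) :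
    U =ᵐ[μ] G := by
  have h1 := tendstoInMeasure_of_tendsto_Lp hU.tendsto_sum_nat
  obtain ⟨φ, hφ, h2⟩ := h1.exists_seq_tendsto_ae
  have h3 : ∀ᵐ x ∂μ, ∀ n, (∑ k ∈ Finset.range n, u k : Lp ℂ 2 μ) x =
      ∑ k ∈ Finset.range n, u k x := by
    refine ae_all_iff.2 fun n => ?_
    induction n with
    | zero =>
      filter_upwards [Lp.coeFn_zero ℂ 2 μ] with x hx
      simpa using hx
    | succ n ih =>
      simp only [Finset.sum_range_succ]
      filter_upwards [ih, Lp.coeFn_add (∑ k ∈ Finset.range n, u k) (u n)] with x h1 h2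
      rw [h2, Pi.add_apply, h1]
  filter_upwards [h2, h3, ae_all_iff.2 huv, hG] with x hx2 hx3 hx4 hx5
  refine tendsto_nhds_unique hx2 ?_
  simp only [hx3, hx4]
  exact hx5.tendsto_sum_nat.comp hφ.tendsto_atTop

theorem Lp_two_norm_sq_eq {X : Type*} {mX : MeasurableSpace X} {μ : Measure X} (f : Lp ℂ 2 μ) :
    ‖f‖ ^ 2 = ∫ x, ‖f x‖ ^ 2 ∂μ := by
  have h : ((‖f‖ ^ 2 : ℝ) : ℂ) = ((∫ x, ‖f x‖ ^ 2 ∂μ : ℝ) : ℂ) := by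
    have := inner_self_eq_norm_sq_to_K (𝕜 := ℂ) f
    rw [L2.inner_def] at this
    rw [← integral_complex_ofReal]
    push_cast
    rw [← show inner ℂ f f = (‖f‖ : ℂ) ^ 2 from inner_self_eq_norm_sq_to_K (𝕜 := ℂ) f,
      L2.inner_def]
    refine integral_congr_ae (.of_forall fun x => ?_)
    exact inner_self_eq_norm_sq_to_K (𝕜 := ℂ) (f x)
  exact_mod_cast h

/-- The absolute value makes the multiplier a contraction for every real ε, so the damping operator
is total in ε. -/
theorem memLp_damping (ε : ℝ) (g : HalfLineL2) :
    MemLp (fun ξ : ℝ => (Real.exp (-(|ε| * ξ)) : ℂ) * g ξ) 2 (volume.restrict (Set.Ioi (0 : ℝ))) := by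
  refine (Lp.memLp g).of_le (AEStronglyMeasurable.mul (by fun_prop) (Lp.aestronglyMeasurable g)) ?_
  filter_upwards [ae_restrict_mem measurableSet_Ioi] with ξ hξ
  have hξ : 0 < ξ := hξ
  rw [norm_mul, Complex.norm_real, Real.norm_of_nonneg (Real.exp_pos _).le]
  refine mul_le_of_le_one_left (norm_nonneg _) (Real.exp_le_one_iff.2 ?_)
  have : 0 ≤ |ε| * ξ := by positivity
  linarith

theorem norm_damping_le (ε : ℝ) (g : HalfLineL2) : ‖(memLp_damping ε g).toLp _‖ ≤ ‖g‖ := by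
  refine Lp.norm_le_norm_of_ae_le ?_
  filter_upwards [ae_restrict_mem measurableSet_Ioi, (memLp_damping ε g).coeFn_toLp] with ξ hξ h
  have hξ : 0 < ξ := hξ
  rw [h, norm_mul, Complex.norm_real, Real.norm_of_nonneg (Real.exp_pos _).le]
  refine mul_le_of_le_one_left (norm_nonneg _) (Real.exp_le_one_iff.2 ?_)
  have : 0 ≤ |ε| * ξ := by positivity
  linarith

/-- Multiplication by `e ^ {-|ε|ξ}` on `L²` of the half-line. -/
def damping (ε : ℝ) : HalfLineL2 →L[ℂ] HalfLineL2 :=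
  LinearMap.mkContinuous
    { toFun := fun g => (memLp_damping ε g).toLp _
      map_add' := fun g h => by
        rw [← MemLp.toLp_add]
        refine MemLp.toLp_congr _ _ ?_
        filter_upwards [Lp.coeFn_add g h] with ξ hξ
        rw [hξ, Pi.add_apply, Pi.add_apply, mul_add]
      map_smul' := fun c g => by
        rw [RingHom.id_apply, ← MemLp.toLp_const_smul]
        refine MemLp.toLp_congr _ _ ?_
        filter_upwards [Lp.coeFn_smul c g] with ξ hξ
        simp only [hξ, Pi.smul_apply, smul_eq_mul]
        ring } 1 fun g => by
    rw [one_mul]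
    exact norm_damping_le ε g

theorem damping_ae_eq (ε : ℝ) (g : HalfLineL2) :
    damping ε g =ᵐ[volume.restrict (Set.Ioi (0 : ℝ))]
      fun ξ => (Real.exp (-(|ε| * ξ)) : ℂ) * g ξ :=
  (memLp_damping ε g).coeFn_toLp

theorem norm_damping (ε : ℝ) : ‖damping ε‖ ≤ 1 :=
  LinearMap.mkContinuous_norm_le _ zero_le_one _

theorem tendsto_damping (g : HalfLineL2) :
    Tendsto (fun ε : ℝ => ‖damping ε g - g‖ ^ 2) (𝓝[>] 0) (𝓝 0) := by
  have e (ε : ℝ) : ‖damping ε g - g‖ ^ 2 = ∫ ξ in Set.Ioi (0 : ℝ),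
      ‖((Real.exp (-(|ε| * ξ)) : ℂ) - 1) * g ξ‖ ^ 2 := by
    rw [Lp_two_norm_sq_eq]
    refine integral_congr_ae ?_
    filter_upwards [damping_ae_eq ε g, Lp.coeFn_sub (damping ε g) g] with ξ h1 h2
    rw [h2, Pi.sub_apply, h1, sub_mul, one_mul]
  simp only [e]
  refine (?_ : Tendsto _ _ (𝓝 (∫ ξ in Set.Ioi (0 : ℝ), (0 : ℝ)))).trans (by simp)
  refine tendsto_integral_filter_of_dominated_convergence (fun ξ => ‖g ξ‖ ^ 2)
    (.of_forall fun ε => ?_) (.of_forall fun ε => ?_) ?_ ?_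
  · have := (Lp.aestronglyMeasurable g)
    refine (AEStronglyMeasurable.mul (by fun_prop) this).norm.pow 2
  · filter_upwards [ae_restrict_mem measurableSet_Ioi] with ξ hξ
    have hξ : 0 < ξ := hξ
    rw [Real.norm_of_nonneg (by positivity), norm_mul, mul_pow]
    refine mul_le_of_le_one_left (by positivity) (pow_le_one₀ (norm_nonneg _) ?_)
    have h1 : Real.exp (-(|ε| * ξ)) ≤ 1 := Real.exp_le_one_iff.2 (by
      have : 0 ≤ |ε| * ξ := by positivity
      linarith)
    have h2 := Real.exp_pos (-(|ε| * ξ))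
    rw [← Complex.ofReal_one, ← Complex.ofReal_sub, Complex.norm_real, Real.norm_eq_abs, abs_le]
    constructor <;> linarith
  · exact (memLp_two_iff_integrable_sq_norm (Lp.aestronglyMeasurable g)).1 (Lp.memLp g)
  · refine .of_forall fun ξ => ?_
    have hc : Continuous fun ε : ℝ => ‖((Real.exp (-(|ε| * ξ)) : ℂ) - 1) * g ξ‖ ^ 2 := by
      fun_prop
    have := hc.tendsto 0
    simp only [abs_zero, zero_mul, neg_zero, Real.exp_zero, Complex.ofReal_one, sub_self,
      norm_zero, ne_eq, OfNat.ofNat_ne_zero, not_false_eq_true, zero_pow] at this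
    exact this.mono_left nhdsWithin_le_nhds

instance : Nontrivial HalfLineL2 := by
  refine ⟨indicatorConstLp 2 (measurableSet_Ioc (a := (0 : ℝ)) (b := 1)) ?_ (1 : ℂ), 0, ?_⟩
  · rw [Measure.restrict_apply measurableSet_Ioc]
    exact ((measure_mono Set.inter_subset_left).trans_lt (by simp)).ne
  · intro h
    have := congrArg norm h
    rw [norm_indicatorConstLp (by simp) (by simp), norm_zero, measureReal_def,
      Measure.restrict_apply measurableSet_Ioc,
      Set.inter_eq_left.2 Set.Ioc_subset_Ioi_self] at this
    simp at this

/-! ### The two families of modes and the symbol. -/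

/-- The exponent `q = (2k + 1 + r) / γ` of the symbol function. -/
def lerayExponent (γ r : ℝ) (k : ℕ) : ℝ := (2 * k + 1 + r) / γ

theorem lerayExponent_pos {γ r : ℝ} (hγ : 1 < γ) (hr : r ∈ Set.Ioo (-1) (2 * γ - 1)) (k : ℕ) :
    0 < lerayExponent γ r k := by
  have hk : (0 : ℝ) ≤ k := by positivity
  exact div_pos (by linarith [hr.1]) (by linarith)

theorem sub_lerayExponent_pos {γ r : ℝ} (hγ : 1 < γ) (hr : r ∈ Set.Ioo (-1) (2 * γ - 1)) (k : ℕ) :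
    0 < 2 * k + 2 - lerayExponent γ r k := by
  have hk : (0 : ℝ) ≤ k := by positivity
  rw [lerayExponent, sub_pos, div_lt_iff₀ (by linarith)]
  nlinarith [hr.2]

theorem mul_lerayExponent {γ : ℝ} (hγ : 1 < γ) (r : ℝ) (k : ℕ) :
    γ * lerayExponent γ r k = r + 2 * (k : ℝ) + 1 := by
  rw [lerayExponent, mul_div_cancel₀ _ (by linarith)]
  ring

/-- The isometry condition γp = r + 2a + 1 for p = 2k + 2 - q forces a = (γ-1)(k+1) - r. -/
theorem mul_sub_lerayExponent {γ : ℝ} (hγ : 1 < γ) (r : ℝ) (k : ℕ) :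
    γ * (2 * k + 2 - lerayExponent γ r k) = r + 2 * ((γ - 1) * (k + 1) - r) + 1 := by
  rw [mul_sub, mul_lerayExponent hγ]
  ring

/-- The modes spanning the range of the Leray transform. -/
def rangeMode {γ r : ℝ} (hγ : 1 < γ) (hr : r ∈ Set.Ioo (-1) (2 * γ - 1)) (k : ℕ) :
    HalfLineL2 →ₗᵢ[ℂ] LerayL2 γ r :=
  modeIsometry hγ (lerayExponent_pos hγ hr k) one_pos (mul_lerayExponent hγ r k) (k : ℤ)

/-- The modes spanning the orthogonal complement of the kernel of the Leray transform. -/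
def sourceMode {γ r : ℝ} (hγ : 1 < γ) (hr : r ∈ Set.Ioo (-1) (2 * γ - 1)) (k : ℕ) :
    HalfLineL2 →ₗᵢ[ℂ] LerayL2 γ r :=
  modeIsometry hγ (sub_lerayExponent_pos hγ hr k) (sub_pos.2 hγ) (mul_sub_lerayExponent hγ r k)
    (k : ℤ)

theorem orthogonalFamily_rangeMode {γ r : ℝ} (hγ : 1 < γ) (hr : r ∈ Set.Ioo (-1) (2 * γ - 1)) :
    OrthogonalFamily ℂ (fun _ : ℕ => HalfLineL2) (rangeMode hγ hr) := fun _ _ hij _ _ =>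
  inner_modeIsometry_eq_zero hγ _ _ _ _ _ _ (by exact_mod_cast hij) _ _

theorem orthogonalFamily_sourceMode {γ r : ℝ} (hγ : 1 < γ) (hr : r ∈ Set.Ioo (-1) (2 * γ - 1)) :
    OrthogonalFamily ℂ (fun _ : ℕ => HalfLineL2) (sourceMode hγ hr) := fun _ _ hij _ _ =>
  inner_modeIsometry_eq_zero hγ _ _ _ _ _ _ (by exact_mod_cast hij) _ _

/-- Angular frequency -1 is missed by both families; this vector makes 0 an eigenvalue of both
products. -/
theorem exists_orthogonal_modes {γ r : ℝ} (hγ : 1 < γ) (hr : r ∈ Set.Ioo (-1) (2 * γ - 1)) :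
    ∃ v : LerayL2 γ r, v ≠ 0 ∧ (∀ k g, inner ℂ (rangeMode hγ hr k g) v = 0) ∧
      ∀ k g, inner ℂ (sourceMode hγ hr k g) v = 0 := by
  obtain ⟨x, hx⟩ := exists_ne (0 : HalfLineL2)
  have hk (k : ℕ) : (k : ℤ) ≠ -1 := by omega
  refine ⟨modeIsometry hγ (lerayExponent_pos hγ hr 0) one_pos (mul_lerayExponent hγ r 0) (-1) x,
    ?_, fun k g => ?_, fun k g => ?_⟩
  · exact fun h => hx (LinearIsometry.injective _ (h.trans (map_zero _).symm))
  · exact inner_modeIsometry_eq_zero hγ _ _ _ _ _ _ (hk k) _ _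
  · exact inner_modeIsometry_eq_zero hγ _ _ _ _ _ _ (hk k) _ _

/-- The right-hand side, times (k+1)! from the Laplace integral, gives the coefficient of the k-th
kernel term. This identity is the origin of the symbol. -/
theorem sqrt_leraySymbol_mul_modeConst {γ r : ℝ} (hγ : 1 < γ) (hr : r ∈ Set.Ioo (-1) (2 * γ - 1))
    (k : ℕ) :
    √(leraySymbol γ r k) * modeConst γ (lerayExponent γ r k) 1 *
      modeConst γ (2 * k + 2 - lerayExponent γ r k) (γ - 1) =
      γ ^ 2 / (4 * Real.pi ^ 2) * γ ^ k / k.factorial := by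
  have hg : 0 < γ - 1 := by linarith
  have hg0 : 0 < γ := by linarith
  have hpi := Real.pi_pos
  have hq := lerayExponent_pos hγ hr k
  have hp := sub_lerayExponent_pos hγ hr k
  have hC := leraySymbol_pos hγ hr k
  set q := lerayExponent γ r k with hqdef
  set p := 2 * (k : ℝ) + 2 - q with hpdef
  have hGq := Real.Gamma_pos_of_pos hq
  have hGp := Real.Gamma_pos_of_pos hp
  refine (sq_eq_sq₀ (by unfold modeConst; positivity) (by positivity)).1 ?_
  rw [mul_pow, mul_pow, Real.sq_sqrt hC.le, modeConst, modeConst, Real.sq_sqrt (by positivity),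
    Real.sq_sqrt (by positivity)]
  have hCe : leraySymbol γ r k = Real.Gamma q * Real.Gamma p / k.factorial ^ 2 *
      (γ / 2) ^ (2 * k + 2) * (γ - 1) ^ (-p) := by
    rw [← Real.Gamma_nat_eq_factorial]; rfl
  have h2 : (2 : ℝ) ^ q * 2 ^ p = 2 ^ (2 * k + 2) := by
    rw [← Real.rpow_add two_pos, show q + p = ((2 * k + 2 : ℕ) : ℝ) by
      rw [hpdef]; push_cast; ring, Real.rpow_natCast]
  have h3 := Real.rpow_pos_of_pos hg p
  rw [hCe, mul_one, Real.mul_rpow two_pos.le hg.le, Real.rpow_neg hg.le, div_pow]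
  calc _ = γ ^ (2 * k + 2) * γ ^ 2 / (16 * Real.pi ^ 4 * k.factorial ^ 2) *
        ((2 : ℝ) ^ q * 2 ^ p) / 2 ^ (2 * k + 2) := by field_simp; norm_num
    _ = _ := by
      rw [h2]
      field_simp
      ring

/-! ### Frequency profiles of the kernel. -/

/-- The frequency profiles of the Leray kernel with pole `z`. -/
def lerayProfile (γ r : ℝ) (z : ℂ × ℂ) (k : ℕ) (ξ : ℝ) : ℂ :=
  conj (((√(leraySymbol γ r k) * modeConst γ (lerayExponent γ r k) 1 : ℝ) : ℂ) * z.1 ^ k *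
    ((ξ ^ (lerayExponent γ r k / 2) : ℝ) : ℂ) * Complex.exp (Complex.I * ξ * z.2))

theorem norm_lerayProfile {γ r : ℝ} (z : ℂ × ℂ) (k : ℕ) {ξ : ℝ} (hξ : 0 < ξ) :
    ‖lerayProfile γ r z k ξ‖ = √(leraySymbol γ r k) * modeConst γ (lerayExponent γ r k) 1 *
      ‖z.1‖ ^ k * (ξ ^ (lerayExponent γ r k / 2) * Real.exp (-(z.2.im * ξ))) := by
  have h0 : 0 ≤ modeConst γ (lerayExponent γ r k) 1 := Real.sqrt_nonneg _
  rw [lerayProfile, RCLike.norm_conj, norm_mul, norm_mul, norm_mul, Complex.norm_real,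
    Complex.norm_real, Real.norm_of_nonneg (by positivity), Real.norm_of_nonneg (by positivity),
    norm_pow, Complex.norm_exp]
  simp
  ring_nf

theorem memLp_lerayProfile {γ r : ℝ} (hγ : 1 < γ) (hr : r ∈ Set.Ioo (-1) (2 * γ - 1))
    {z : ℂ × ℂ} (hz : 0 < z.2.im) (k : ℕ) :
    MemLp (lerayProfile γ r z k) 2 (volume.restrict (Set.Ioi (0 : ℝ))) := by
  have hq := lerayExponent_pos hγ hr k
  have h := (memLp_rpow_mul_exp (by linarith : -1 < lerayExponent γ r k) hz).const_mul
    ((√(leraySymbol γ r k) * modeConst γ (lerayExponent γ r k) 1 * ‖z.1‖ ^ k : ℝ) : ℂ)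
  refine h.congr_norm ?_ ?_
  · unfold lerayProfile
    refine Measurable.aestronglyMeasurable ?_
    exact Complex.continuous_conj.measurable.comp (by fun_prop)
  · filter_upwards [ae_restrict_mem measurableSet_Ioi] with ξ hξ
    have hξ : 0 < ξ := hξ
    have h0 : 0 ≤ modeConst γ (lerayExponent γ r k) 1 := Real.sqrt_nonneg _
    rw [norm_lerayProfile z k hξ, norm_mul, Complex.norm_real, Complex.norm_real,
      Real.norm_of_nonneg (by positivity), Real.norm_of_nonneg (by positivity)]

theorem norm_sq_lerayProfile {γ r : ℝ} (hγ : 1 < γ) (hr : r ∈ Set.Ioo (-1) (2 * γ - 1))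
    {z : ℂ × ℂ} (hz : 0 < z.2.im) (k : ℕ) :
    ‖(memLp_lerayProfile hγ hr hz k).toLp _‖ ^ 2 = leraySymbol γ r k * γ / (8 * Real.pi ^ 2) *
      lerayExponent γ r k * ‖z.1‖ ^ (2 * k) * z.2.im ^ (-(lerayExponent γ r k + 1)) := by
  have hq := lerayExponent_pos hγ hr k
  have hC := leraySymbol_pos hγ hr k
  have hg0 : 0 < γ := by linarith
  have hpi := Real.pi_pos
  set q := lerayExponent γ r k with hqdef
  have hGq := Real.Gamma_pos_of_pos hq
  rw [Lp_two_norm_sq_eq]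
  have e : ∫ ξ in Set.Ioi (0 : ℝ), ‖(memLp_lerayProfile hγ hr hz k).toLp _ ξ‖ ^ 2 =
      ∫ ξ in Set.Ioi (0 : ℝ), (leraySymbol γ r k * modeConst γ q 1 ^ 2 * ‖z.1‖ ^ (2 * k)) *
        (ξ ^ (q + 1 - 1) * Real.exp (-(2 * z.2.im * ξ))) := by
    refine integral_congr_ae ?_
    filter_upwards [ae_restrict_mem measurableSet_Ioi,
      (memLp_lerayProfile hγ hr hz k).coeFn_toLp] with ξ hξ h
    have hξ : 0 < ξ := hξ
    rw [h, norm_lerayProfile z k hξ, mul_pow, mul_pow, mul_pow, mul_pow, Real.sq_sqrt hC.le,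
      ← Real.rpow_mul_natCast hξ.le, ← Real.exp_nat_mul, ← pow_mul, mul_comm k 2, ← hqdef]
    push_cast
    ring_nf
  rw [e, integral_const_mul, Real.integral_rpow_mul_exp_neg_mul_Ioi (by linarith) (by positivity),
    Real.Gamma_add_one hq.ne', modeConst, Real.sq_sqrt (by positivity), one_div,
    Real.inv_rpow (by positivity), Real.mul_rpow two_pos.le hz.le, Real.rpow_neg hz.le,
    Real.rpow_add_one two_ne_zero, mul_one]
  have := Real.rpow_pos_of_pos two_pos q
  have := Real.rpow_pos_of_pos hz (q + 1)
  field_simp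
  ring

/-- As the symbol is bounded, the squared norms are at most an affine function of k times ρ^k with ρ
= |z₁|²/(Im z₂)^{2/γ}, and ρ < 1 is the condition z ∈ Ω_γ. -/
theorem summable_norm_sq_lerayProfile {γ r : ℝ} (hγ : 1 < γ) (hr : r ∈ Set.Ioo (-1) (2 * γ - 1))
    {z : ℂ × ℂ} (hz : z ∈ lerayDomain γ) (hz' : 0 < z.2.im) :
    Summable fun k => ‖(memLp_lerayProfile hγ hr hz' k).toLp _‖ ^ 2 := by
  obtain ⟨C, hC⟩ := exists_leraySymbol_le hγ r
  have hg0 : 0 < γ := by linarith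
  have hpi := Real.pi_pos
  have hz : ‖z.1‖ ^ γ < z.2.im := hz
  set y := z.2.im with hy
  set ρ := ‖z.1‖ ^ 2 * y ^ (-(2 / γ)) with hρ
  have hρ0 : 0 ≤ ρ := by positivity
  have hρ1 : ρ < 1 := by
    rw [hρ, Real.rpow_neg hz'.le, ← div_eq_mul_inv, div_lt_one (by positivity)]
    calc ‖z.1‖ ^ 2 = (‖z.1‖ ^ γ) ^ (2 / γ) := by
          rw [← Real.rpow_mul (norm_nonneg _), mul_div_cancel₀ _ hg0.ne']
          norm_cast
      _ < y ^ (2 / γ) := Real.rpow_lt_rpow (by positivity) hz (by positivity)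
  have hs1 : Summable fun k : ℕ => (k : ℝ) * ρ ^ k := by
    simpa using summable_pow_mul_geometric_of_norm_lt_one 1
      (by rwa [Real.norm_of_nonneg hρ0] : ‖ρ‖ < 1)
  have hs0 : Summable fun k : ℕ => ρ ^ k := summable_geometric_of_lt_one hρ0 hρ1
  have hs := ((hs1.mul_left (2 / γ)).add (hs0.mul_left ((1 + r) / γ))).mul_left
    (C * γ / (8 * Real.pi ^ 2) * y ^ (-((1 + r) / γ + 1)))
  refine Summable.of_nonneg_of_le (fun k => by positivity) (fun k => ?_) hs
  have hq := lerayExponent_pos hγ hr k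
  rw [norm_sq_lerayProfile hγ hr hz' k]
  calc _ ≤ C * γ / (8 * Real.pi ^ 2) *
      lerayExponent γ r k * ‖z.1‖ ^ (2 * k) * y ^ (-(lerayExponent γ r k + 1)) := by
        gcongr
        exact hC k
    _ = _ := by
        rw [show -(lerayExponent γ r k + 1) = -((1 + r) / γ + 1) + -(2 / γ) * k by
          unfold lerayExponent; field_simp; ring, Real.rpow_add hz', Real.rpow_mul hz'.le,
          Real.rpow_natCast, pow_mul, hρ, mul_pow,
          show lerayExponent γ r k = 2 / γ * k + (1 + r) / γ by
            unfold lerayExponent; field_simp; ring]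
        ring

/-- The family of frequency profiles of the Leray kernel with pole `z` in the domain. -/
def lerayProfileSum {γ r : ℝ} (hγ : 1 < γ) (hr : r ∈ Set.Ioo (-1) (2 * γ - 1)) {z : ℂ × ℂ}
    (hz : z ∈ lerayDomain γ) (hz' : 0 < z.2.im) : lp (fun _ : ℕ => HalfLineL2) 2 :=
  ⟨fun k => (memLp_lerayProfile hγ hr hz' k).toLp _,
    memℓp_gen (by simpa using summable_norm_sq_lerayProfile hγ hr hz hz')⟩

theorem lerayDomain_im_pos {γ : ℝ} {z : ℂ × ℂ} (hz : z ∈ lerayDomain γ) : 0 < z.2.im :=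
  lt_of_le_of_lt (by positivity) (show ‖z.1‖ ^ γ < z.2.im from hz)

/-! ### Expansion of the kernel in source modes. -/

/-- Young's inequality with exponents γ and γ/(γ-1). It yields |Q| < Re P, hence convergence of the
kernel expansion on all of Ω_γ. -/
theorem young_leray {γ a b : ℝ} (hγ : 1 < γ) (ha : 0 ≤ a) (hb : 0 ≤ b) :
    γ * a * b ^ (γ - 1) ≤ (γ - 1) * b ^ γ + a ^ γ := by
  have hg : 0 < γ - 1 := by linarith
  have h := Real.young_inequality_of_nonneg ha (by positivity : 0 ≤ b ^ (γ - 1))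
    (Real.HolderConjugate.conjExponent hγ)
  rw [← Real.rpow_mul hb, Real.conjExponent, mul_div_cancel₀ _ hg.ne'] at h
  have h2 := mul_le_mul_of_nonneg_left h (by linarith : 0 ≤ γ)
  calc γ * a * b ^ (γ - 1) = γ * (a * b ^ (γ - 1)) := by ring
    _ ≤ _ := h2
    _ = _ := by field_simp; ring

theorem norm_pow_mul_exp (P : ℂ) (n : ℕ) {ξ : ℝ} (hξ : 0 < ξ) :
    ‖((ξ ^ n : ℝ) : ℂ) * Complex.exp (-(P * ξ))‖ = ξ ^ (n : ℝ) * Real.exp (-P.re * ξ) := by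
  rw [norm_mul, Complex.norm_real, Real.norm_of_nonneg (by positivity), Complex.norm_exp]
  simp

theorem integrableOn_pow_mul_exp {P : ℂ} (hP : 0 < P.re) (n : ℕ) :
    IntegrableOn (fun ξ : ℝ => ((ξ ^ n : ℝ) : ℂ) * Complex.exp (-(P * ξ))) (Set.Ioi 0) := by
  have h := integrableOn_rpow_mul_exp_neg_mul_rpow (s := n) (p := 1) (b := P.re)
    (by linarith [Nat.cast_nonneg (α := ℝ) n]) one_pos hP
  refine Integrable.mono' h (by fun_prop) ?_
  filter_upwards [ae_restrict_mem measurableSet_Ioi] with ξ hξ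
  rw [norm_pow_mul_exp P n hξ, Real.rpow_one]

theorem integral_pow_mul_exp {P : ℂ} (hP : 0 < P.re) (n : ℕ) :
    ∫ ξ in Set.Ioi (0 : ℝ), ((ξ ^ n : ℝ) : ℂ) * Complex.exp (-(P * ξ)) =
      n.factorial / P ^ (n + 1) := by
  have hP0 : P ≠ 0 := fun h => by simp [h] at hP
  induction n with
  | zero =>
    have := integral_exp_mul_complex_Ioi (a := -P) (by simpa using hP) 0
    simpa using this
  | succ n ih =>
    have hd (ξ : ℝ) : HasDerivAt (fun ξ : ℝ => ((ξ ^ (n + 1) : ℝ) : ℂ) * Complex.exp (-(P * ξ)))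
        ((n + 1) * (((ξ ^ n : ℝ) : ℂ) * Complex.exp (-(P * ξ))) -
          P * (((ξ ^ (n + 1) : ℝ) : ℂ) * Complex.exp (-(P * ξ)))) ξ := by
      have h1 := (hasDerivAt_pow (n + 1) ξ).ofReal_comp
      have h2 : HasDerivAt (fun ξ : ℝ => Complex.exp (-(P * ξ)))
          (Complex.exp (-(P * ξ)) * -(P * 1)) ξ :=
        (((hasDerivAt_id (ξ : ℂ)).const_mul P).neg.cexp).comp_ofReal
      refine (h1.mul h2).congr_deriv ?_
      push_cast
      ring
    have hi := ((integrableOn_pow_mul_exp hP n).const_mul ((n : ℂ) + 1)).sub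
      ((integrableOn_pow_mul_exp hP (n + 1)).const_mul P)
    have ht : Tendsto (fun ξ : ℝ => ((ξ ^ (n + 1) : ℝ) : ℂ) * Complex.exp (-(P * ξ))) atTop
        (𝓝 0) := by
      rw [tendsto_zero_iff_norm_tendsto_zero]
      refine (tendsto_rpow_mul_exp_neg_mul_atTop_nhds_zero ((n + 1 : ℕ) : ℝ) P.re hP).congr' ?_
      filter_upwards [eventually_gt_atTop 0] with ξ hξ
      exact (norm_pow_mul_exp P (n + 1) hξ).symm
    have h := integral_Ioi_of_hasDerivAt_of_tendsto' (a := 0) (fun ξ _ => hd ξ) hi ht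
    rw [integral_sub ((integrableOn_pow_mul_exp hP n).const_mul _)
      ((integrableOn_pow_mul_exp hP (n + 1)).const_mul _), integral_const_mul,
      integral_const_mul, ih] at h
    have h' : P * ∫ ξ in Set.Ioi (0 : ℝ), ((ξ ^ (n + 1) : ℝ) : ℂ) * Complex.exp (-(P * ξ)) =
        (n + 1) * (n.factorial / P ^ (n + 1)) := by
      rw [← sub_eq_zero, ← neg_eq_zero, neg_sub, h]
      simp
    rw [← mul_right_inj' hP0, h', Nat.factorial_succ]
    push_cast
    field_simp
    ring

/-- The modes of the frequency profiles of the Leray kernel. -/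
theorem modeFun_lerayProfile {γ r : ℝ} (hγ : 1 < γ) (hr : r ∈ Set.Ioo (-1) (2 * γ - 1))
    {z : ℂ × ℂ} (hz : 0 < z.2.im) (k : ℕ) {ζ : lerayHypersurface γ} (hζ : ζ.1.1 ≠ 0) :
    modeFun γ (2 * k + 2 - lerayExponent γ r k) ((γ - 1) * (k + 1) - r) (γ - 1) k
      (lerayProfile γ r z k) ζ =
    (γ : ℂ) ^ 2 / (4 * (Real.pi : ℂ) ^ 2) * ((‖ζ.1.1‖ ^ (γ - 1 - r) : ℝ) : ℂ) *
      ((k + 1) * (γ * conj z.1 * ζ.1.1 * ((‖ζ.1.1‖ ^ (γ - 2) : ℝ) : ℂ)) ^ k /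
        (((γ - 1) * ‖ζ.1.1‖ ^ γ : ℝ) - Complex.I * ζ.1.2.re + Complex.I * conj z.2) ^ (k + 2)) := by
  have hα : 0 < ‖ζ.1.1‖ := norm_pos_iff.2 hζ
  have hαC : (‖ζ.1.1‖ : ℂ) ≠ 0 := by exact_mod_cast hα.ne'
  set α := ‖ζ.1.1‖ with hαdef
  set P : ℂ := ((γ - 1) * α ^ γ : ℝ) - Complex.I * ζ.1.2.re + Complex.I * conj z.2 with hP
  have hg : 0 < γ - 1 := by linarith
  have hPre : 0 < P.re := by
    have : P.re = (γ - 1) * α ^ γ + z.2.im := by simp [hP]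
    rw [this]
    positivity
  have hint : ∫ ξ in Set.Ioi (0 : ℝ), modeIntegrand γ (2 * k + 2 - lerayExponent γ r k) (γ - 1)
      (lerayProfile γ r z k) α ζ.1.2.re ξ =
      ((γ ^ 2 / (4 * Real.pi ^ 2) * γ ^ k / k.factorial : ℝ) : ℂ) * conj z.1 ^ k *
        ((k + 1).factorial / P ^ (k + 2)) := by
    rw [← integral_pow_mul_exp hPre, ← integral_const_mul]
    refine setIntegral_congr_fun measurableSet_Ioi fun ξ hξ => ?_
    have hξ : 0 < ξ := hξ
    -- The exponents of profile and source mode add up to 2k + 2, so the half powers give the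
    -- ξ^{k+1} of the Laplace integral for P^{-(k+2)}.
    have e1 : ξ ^ (k + 1) = ξ ^ (lerayExponent γ r k / 2) *
        ξ ^ ((2 * k + 2 - lerayExponent γ r k) / 2) := by
      rw [← Real.rpow_add hξ, ← Real.rpow_natCast]
      congr 1
      push_cast
      ring
    have e2 : conj (Complex.exp (Complex.I * ξ * z.2)) =
        Complex.exp (-(Complex.I * ξ * conj z.2)) := by
      rw [← Complex.exp_conj]
      simp
    have e3 : Complex.exp (-(P * ξ)) = Complex.exp (-(Complex.I * ξ * conj z.2)) *
        (Real.exp (-((γ - 1) * α ^ γ * ξ)) : ℂ) * Complex.exp (Complex.I * ξ * ζ.1.2.re) := by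
      rw [Complex.ofReal_exp, ← Complex.exp_add, ← Complex.exp_add, hP]
      congr 1
      push_cast
      ring
    simp only [modeIntegrand, lerayProfile, map_mul, map_pow, Complex.conj_ofReal]
    rw [e2, e3, ← sqrt_leraySymbol_mul_modeConst hγ hr k, e1]
    push_cast
    ring
  -- The first factor is the density of σ with respect to μ_r, the second belongs to Q^k, and α^k
  -- cancels the modulus in (ζ₁/|ζ₁|)^k.
  have hpow : α ^ ((γ - 1) * (k + 1) - r) = α ^ (γ - 1 - r) * (α ^ (γ - 2)) ^ k * α ^ k := by
    rw [← Real.rpow_mul_natCast hα.le, ← Real.rpow_natCast α k, ← Real.rpow_add hα,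
      ← Real.rpow_add hα]
    ring_nf
  unfold modeFun
  rw [← hαdef, hint, hpow, zpow_natCast, div_pow, Nat.factorial_succ]
  have hf : (k.factorial : ℂ) ≠ 0 := by exact_mod_cast k.factorial_ne_zero
  have hP0 : P ≠ 0 := fun h => by simp [h] at hPre
  have hpi : (Real.pi : ℂ) ≠ 0 := by exact_mod_cast Real.pi_ne_zero
  push_cast
  field_simp
  ring

theorem hasSum_geometric_deriv {P Q : ℂ} (h : ‖Q‖ < ‖P‖) :
    HasSum (fun k : ℕ => ((k : ℂ) + 1) * Q ^ k / P ^ (k + 2)) (1 / (P - Q) ^ 2) := by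
  have hP : P ≠ 0 := norm_pos_iff.1 ((norm_nonneg _).trans_lt h)
  have hx : ‖Q / P‖ < 1 := by
    rw [norm_div, div_lt_one (norm_pos_iff.2 hP)]
    exact h
  have h1 := ((hasSum_coe_mul_geometric_of_norm_lt_one hx).add
    (hasSum_geometric_of_norm_lt_one hx)).mul_left (1 / P ^ 2)
  have hPQ : P - Q ≠ 0 := fun h0 => by rw [sub_eq_zero.1 h0] at h; exact lt_irrefl _ h
  have hPQ' : 1 - Q / P ≠ 0 := by
    rw [one_sub_div hP]
    exact div_ne_zero hPQ hP
  convert! h1 using 1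
  · ext k
    rw [div_pow]
    field_simp
    ring
  · rw [one_sub_div hP]
    field_simp
    ring

theorem hasSum_modeFun_lerayProfile {γ r : ℝ} (hγ : 1 < γ) (hr : r ∈ Set.Ioo (-1) (2 * γ - 1))
    {z : ℂ × ℂ} (hz : z ∈ lerayDomain γ) {ζ : lerayHypersurface γ} (hζ : ζ.1.1 ≠ 0) :
    HasSum (fun k : ℕ => modeFun γ (2 * k + 2 - lerayExponent γ r k) ((γ - 1) * (k + 1) - r)
      (γ - 1) k (lerayProfile γ r z k) ζ)
      (((‖ζ.1.1‖ ^ (γ - 1 - r) : ℝ) : ℂ) * conj (lerayKernel γ z ζ)) := by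
  have hz' := lerayDomain_im_pos hz
  have hz : ‖z.1‖ ^ γ < z.2.im := hz
  have hα : 0 < ‖ζ.1.1‖ := norm_pos_iff.2 hζ
  have him : ζ.1.2.im = ‖ζ.1.1‖ ^ γ := ζ.2
  have hgam : ‖ζ.1.1‖ ^ (γ - 2) * (‖ζ.1.1‖ * ‖ζ.1.1‖) = ‖ζ.1.1‖ ^ γ := by
    rw [← sq, ← Real.rpow_natCast, ← Real.rpow_add hα]
    congr 1
    push_cast
    ring
  have hgam1 : ‖ζ.1.1‖ ^ (γ - 2) * ‖ζ.1.1‖ = ‖ζ.1.1‖ ^ (γ - 1) := by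
    rw [← Real.rpow_add_one hα.ne']
    congr 1
    ring
  simp only [modeFun_lerayProfile hγ hr hz' _ hζ]
  set P : ℂ := ((γ - 1) * ‖ζ.1.1‖ ^ γ : ℝ) - Complex.I * ζ.1.2.re + Complex.I * conj z.2 with hP
  set Q : ℂ := γ * conj z.1 * ζ.1.1 * ((‖ζ.1.1‖ ^ (γ - 2) : ℝ) : ℂ) with hQ
  have hPre : P.re = (γ - 1) * ‖ζ.1.1‖ ^ γ + z.2.im := by simp [hP]
  have hQn : ‖Q‖ = γ * ‖z.1‖ * ‖ζ.1.1‖ ^ (γ - 1) := by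
    rw [hQ, norm_mul, norm_mul, norm_mul, Complex.norm_real, Complex.norm_real, RCLike.norm_conj,
      Real.norm_of_nonneg (by linarith), Real.norm_of_nonneg (by positivity), ← hgam1]
    ring
  have hPQ : ‖Q‖ < ‖P‖ := by
    refine lt_of_lt_of_le ?_ (Complex.re_le_norm P)
    rw [hPre, hQn]
    linarith [young_leray hγ (norm_nonneg z.1) hα.le]
  -- On M_γ the term Im ζ₂ = |ζ₁|^γ removes one of the γ copies of |ζ₁|^γ, which explains the decay
  -- rate γ - 1 of the source modes.
  have hD : conj ((γ : ℂ) * conj ζ.1.1 * ((‖ζ.1.1‖ ^ (γ - 2) : ℝ) : ℂ) * (ζ.1.1 - z.1)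
      + Complex.I * (ζ.1.2 - z.2)) = P - Q := by
    have h1 : ζ.1.1 * conj ζ.1.1 = ((‖ζ.1.1‖ * ‖ζ.1.1‖ : ℝ) : ℂ) := by
      rw [Complex.mul_conj, Complex.normSq_eq_norm_sq, sq]
    have h2 : conj ζ.1.2 = ζ.1.2.re - ((‖ζ.1.1‖ ^ γ : ℝ) : ℂ) * Complex.I := by
      rw [← him]
      apply Complex.ext <;> simp
    simp only [map_add, map_mul, map_sub, Complex.conj_conj, Complex.conj_ofReal, Complex.conj_I,
      h2]
    have h3 : (γ : ℂ) * ζ.1.1 * ((‖ζ.1.1‖ ^ (γ - 2) : ℝ) : ℂ) * (conj ζ.1.1 - conj z.1) =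
        γ * ((‖ζ.1.1‖ ^ γ : ℝ) : ℂ) - Q := by
      rw [← hgam, Complex.ofReal_mul, ← h1, hQ]
      ring
    rw [h3, hP]
    push_cast
    ring_nf
    simp only [Complex.I_sq]
    ring
  have h := (hasSum_geometric_deriv hPQ).mul_left
    ((γ : ℂ) ^ 2 / (4 * (Real.pi : ℂ) ^ 2) * ((‖ζ.1.1‖ ^ (γ - 1 - r) : ℝ) : ℂ))
  convert! h using 1
  rw [lerayKernel, map_div₀, map_pow, hD]
  simp only [map_div₀, map_mul, map_pow, Complex.conj_ofReal, map_ofNat]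
  ring

theorem sourceMode_lerayProfile {γ r : ℝ} (hγ : 1 < γ) (hr : r ∈ Set.Ioo (-1) (2 * γ - 1))
    {z : ℂ × ℂ} (hz : z ∈ lerayDomain γ) :
    (orthogonalFamily_sourceMode hγ hr).linearIsometry
      (lerayProfileSum hγ hr hz (lerayDomain_im_pos hz)) =ᵐ[lerayMeasure γ r]
      fun ζ => ((‖ζ.1.1‖ ^ (γ - 1 - r) : ℝ) : ℂ) * conj (lerayKernel γ z ζ) := by
  have hz' := lerayDomain_im_pos hz
  refine Lp_ae_eq_of_hasSum ((orthogonalFamily_sourceMode hγ hr).hasSum_linearIsometry _)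
    (v := fun k => modeFun γ (2 * k + 2 - lerayExponent γ r k) ((γ - 1) * (k + 1) - r)
      (γ - 1) k (lerayProfile γ r z k)) (fun k => ?_) ?_
  · refine (modeIsometry_ae_eq hγ (sub_lerayExponent_pos hγ hr k) (sub_pos.2 hγ)
      (mul_sub_lerayExponent hγ r k) (k : ℤ) _).trans (.of_forall fun ζ => ?_)
    exact modeFun_congr (memLp_lerayProfile hγ hr hz' k).coeFn_toLp ζ
  · filter_upwards [ae_lerayMeasure_ne_zero γ r] with ζ hζ
    exact hasSum_modeFun_lerayProfile hγ hr hz hζ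

/-! ### The Leray transform as a weighted sum. -/

/-- The density α^{γ-1-r} moves from the measure into the kernel, which then lies in L²(μ_r);
absolute convergence is Cauchy–Schwarz. -/
theorem lerayIntegral_eq_inner {γ r : ℝ} (hγ : 1 < γ) (hr : r ∈ Set.Ioo (-1) (2 * γ - 1))
    (f : LerayL2 γ r) {z : ℂ × ℂ} (hz : z ∈ lerayDomain γ) :
    Integrable (fun ζ : lerayHypersurface γ => f ζ * lerayKernel γ z ζ)
      (lerayMeasure γ (γ - 1)) ∧
    lerayIntegral γ f z = inner ℂ ((orthogonalFamily_sourceMode hγ hr).linearIsometry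
      (lerayProfileSum hγ hr hz (lerayDomain_im_pos hz))) f := by
  have hm : Measurable fun ζ : lerayHypersurface γ =>
      ENNReal.ofReal (‖ζ.1.1‖ ^ (γ - 1 - r)) := by fun_prop
  have hlt : ∀ᵐ ζ ∂lerayMeasure γ r, ENNReal.ofReal (‖ζ.1.1‖ ^ (γ - 1 - r)) < ∞ :=
    .of_forall fun ζ => ENNReal.ofReal_lt_top
  set U := (orthogonalFamily_sourceMode hγ hr).linearIsometry
      (lerayProfileSum hγ hr hz (lerayDomain_im_pos hz)) with hU
  have he : (fun ζ => inner ℂ (U ζ) (f ζ)) =ᵐ[lerayMeasure γ r] fun ζ =>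
      (ENNReal.ofReal (‖ζ.1.1‖ ^ (γ - 1 - r))).toReal • (f ζ * lerayKernel γ z ζ) := by
    filter_upwards [sourceMode_lerayProfile hγ hr hz] with ζ hζ
    rw [hU, hζ, ENNReal.toReal_ofReal (by positivity), RCLike.inner_apply, map_mul,
      Complex.conj_conj, Complex.conj_ofReal, Complex.real_smul]
    ring
  constructor
  · rw [lerayMeasure_withDensity γ r (γ - 1), integrable_withDensity_iff_integrable_smul' hm hlt]
    exact (L2.integrable_inner U f).congr he
  · rw [lerayIntegral, lerayMeasure_withDensity γ r (γ - 1),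
      integral_withDensity_eq_integral_toReal_smul hm hlt, L2.inner_def]
    exact (integral_congr_ae he).symm

theorem shift_mem_lerayDomain {γ ε : ℝ} (hε : 0 < ε) (ζ : lerayHypersurface γ) :
    (ζ.1.1, ζ.1.2 + (ε : ℂ) * Complex.I) ∈ lerayDomain γ := by
  have him : ζ.1.2.im = ‖ζ.1.1‖ ^ γ := ζ.2
  simp [lerayDomain, him, hε]

/-- Pairing with the frequency profiles of the Leray kernel evaluates the modes. -/
theorem inner_lerayProfile {γ r : ℝ} (hγ : 1 < γ) (hr : r ∈ Set.Ioo (-1) (2 * γ - 1))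
    {ε : ℝ} (hε : 0 < ε) {ζ : lerayHypersurface γ} (hζ : ζ.1.1 ≠ 0) (k : ℕ) (g : HalfLineL2)
    (hz : 0 < (ζ.1.2 + (ε : ℂ) * Complex.I).im) :
    inner ℂ ((memLp_lerayProfile hγ hr
      (z := (ζ.1.1, ζ.1.2 + (ε : ℂ) * Complex.I)) hz k).toLp _) g =
    modeFun γ (lerayExponent γ r k) k 1 k
      (((√(leraySymbol γ r k) : ℝ) : ℂ) • damping ε g : HalfLineL2) ζ := by
  have hα : 0 < ‖ζ.1.1‖ := norm_pos_iff.2 hζ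
  have hαC : (‖ζ.1.1‖ : ℂ) ≠ 0 := by exact_mod_cast hα.ne'
  have him : ζ.1.2.im = ‖ζ.1.1‖ ^ γ := ζ.2
  rw [L2.inner_def, modeFun_smul, modeFun_congr (damping_ae_eq ε g), modeFun, ← mul_assoc,
    ← integral_const_mul]
  refine integral_congr_ae ?_
  filter_upwards [(memLp_lerayProfile hγ hr
    (z := (ζ.1.1, ζ.1.2 + (ε : ℂ) * Complex.I)) hz k).coeFn_toLp] with ξ h
  rw [h, RCLike.inner_apply, lerayProfile, Complex.conj_conj, modeIntegrand]
  have e : Complex.exp (Complex.I * ξ * (ζ.1.2 + (ε : ℂ) * Complex.I)) =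
      (Real.exp (-(|ε| * ξ)) : ℂ) * (Real.exp (-(1 * ‖ζ.1.1‖ ^ γ * ξ)) : ℂ) *
        Complex.exp (Complex.I * ξ * ζ.1.2.re) := by
    rw [Complex.ofReal_exp, Complex.ofReal_exp, ← Complex.exp_add, ← Complex.exp_add,
      abs_of_pos hε, ← him]
    congr 1
    conv_lhs => rw [← Complex.re_add_im ζ.1.2]
    push_cast
    ring_nf
    simp only [Complex.I_sq]
    ring
  rw [e, zpow_natCast, div_pow, Real.rpow_natCast]
  push_cast
  field_simp

theorem norm_sqrt_leraySymbol_smul_le {γ r C : ℝ} (hC : ∀ k, leraySymbol γ r k ≤ C) (k : ℕ)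
    {S : HalfLineL2 →L[ℂ] HalfLineL2} (hS : ‖S‖ ≤ 1) :
    ‖((√(leraySymbol γ r k) : ℝ) : ℂ) • S‖ ≤ √C := by
  rw [norm_smul, Complex.norm_real, Real.norm_of_nonneg (Real.sqrt_nonneg _)]
  exact (mul_le_of_le_one_right (Real.sqrt_nonneg _) hS).trans (Real.sqrt_le_sqrt (hC k))

/-- The Leray integral on a translate of the hypersurface, as a sum over modes. -/
theorem lerayShift_ae_eq {γ r : ℝ} (hγ : 1 < γ) (hr : r ∈ Set.Ioo (-1) (2 * γ - 1)) {C : ℝ}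
    (hC : ∀ k, leraySymbol γ r k ≤ C) {ε : ℝ} (hε : 0 < ε) (f : LerayL2 γ r) :
    weightedSum (orthogonalFamily_rangeMode hγ hr) (orthogonalFamily_sourceMode hγ hr)
      (lp.diagonal (fun k => ((√(leraySymbol γ r k) : ℝ) : ℂ) • damping ε) √C
        fun k => norm_sqrt_leraySymbol_smul_le hC k (norm_damping ε)) f =ᵐ[lerayMeasure γ r]
      lerayShift γ ε f := by
  refine Lp_ae_eq_of_hasSum ((orthogonalFamily_rangeMode hγ hr).hasSum_linearIsometry _)
    (fun k => modeIsometry_ae_eq hγ (lerayExponent_pos hγ hr k) one_pos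
      (mul_lerayExponent hγ r k) (k : ℤ) _) ?_
  filter_upwards [ae_lerayMeasure_ne_zero γ r] with ζ hζ
  have hz := shift_mem_lerayDomain hε ζ
  have h := (lerayIntegral_eq_inner hγ hr f hz).2
  -- Moving the source isometry across as its adjoint leaves an ℓ² pairing, whose k-th term is a
  -- range mode.
  rw [lerayShift, h, ← LinearIsometry.coe_toContinuousLinearMap,
    ← ContinuousLinearMap.adjoint_inner_right]
  refine (lp.hasSum_inner _ _).congr_fun fun k => ?_
  exact (inner_lerayProfile hγ hr hε hζ k _ (lerayDomain_im_pos hz)).symm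

/-- Damping tends to the identity only strongly, not in norm, so the limit is taken at each fixed h
by dominated convergence over k, with majorant 4(√C)²‖h k‖². -/
theorem tendsto_diagonal_damping {γ r C : ℝ} (hC : ∀ k, leraySymbol γ r k ≤ C)
    (h : lp (fun _ : ℕ => HalfLineL2) 2) :
    Tendsto (fun ε : ℝ =>
      ‖lp.diagonal (fun k => ((√(leraySymbol γ r k) : ℝ) : ℂ) • damping ε) √C
          (fun k => norm_sqrt_leraySymbol_smul_le hC k (norm_damping ε)) h -
        lp.diagonal (fun k => ((√(leraySymbol γ r k) : ℝ) : ℂ) • ContinuousLinearMap.id ℂ HalfLineL2)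
          √C (fun k => norm_sqrt_leraySymbol_smul_le hC k ContinuousLinearMap.norm_id_le) h‖)
      (𝓝[>] 0) (𝓝 0) := by
  have hsq (x : lp (fun _ : ℕ => HalfLineL2) 2) : ‖x‖ = √(∑' k, ‖x k‖ ^ 2) := by
    have := lp.norm_rpow_eq_tsum (p := 2) (by norm_num) x
    rw [← Real.sqrt_sq (norm_nonneg x)]
    congr 1
    simpa using this
  have hsum : Summable fun k => ‖h k‖ ^ 2 := by
    simpa using (lp.memℓp h).summable (by norm_num)
  have key : Tendsto (fun ε : ℝ => ∑' k, ‖((√(leraySymbol γ r k) : ℝ) : ℂ) •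
      (damping ε (h k) - h k)‖ ^ 2) (𝓝[>] 0) (𝓝 (∑' _ : ℕ, (0 : ℝ))) := by
    refine tendsto_tsum_of_dominated_convergence (hsum.mul_left (√C ^ 2 * 2 ^ 2)) (fun k => ?_)
      (.of_forall fun ε k => ?_)
    · have := (tendsto_damping (h k)).const_mul (√(leraySymbol γ r k) ^ 2)
      simpa [norm_smul, mul_pow, -Complex.coe_smul] using this
    · rw [norm_smul, Complex.norm_real, norm_pow, norm_mul, norm_norm, norm_norm, ← mul_pow,
        ← mul_pow, mul_assoc, Real.norm_of_nonneg (Real.sqrt_nonneg _)]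
      gcongr
      · exact hC k
      · calc ‖damping ε (h k) - h k‖ ≤ ‖damping ε (h k)‖ + ‖h k‖ := norm_sub_le _ _
          _ ≤ 1 * ‖h k‖ + ‖h k‖ := by
              gcongr
              exact (damping ε).le_of_opNorm_le (norm_damping ε) _
          _ = 2 * ‖h k‖ := by ring
  rw [tsum_zero] at key
  have := key.sqrt
  rw [Real.sqrt_zero] at this
  refine this.congr fun ε => ?_
  rw [hsq]
  congr 2 with k
  simp [smul_sub, -Complex.coe_smul]

theorem isLerayTransform_weightedSum {γ r : ℝ} (hγ : 1 < γ) (hr : r ∈ Set.Ioo (-1) (2 * γ - 1))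
    {C : ℝ} (hC : ∀ k, leraySymbol γ r k ≤ C) (f : LerayL2 γ r) :
    IsLerayTransform γ r f (weightedSum (orthogonalFamily_rangeMode hγ hr)
      (orthogonalFamily_sourceMode hγ hr) (lp.diagonal (fun k => ((√(leraySymbol γ r k) : ℝ) : ℂ) •
        ContinuousLinearMap.id ℂ HalfLineL2) √C
          fun k => norm_sqrt_leraySymbol_smul_le hC k ContinuousLinearMap.norm_id_le) f) where
  integrable z hz := (lerayIntegral_eq_inner hγ hr f hz).1
  memLp ε hε := (memLp_congr_ae (lerayShift_ae_eq hγ hr hC hε f)).1 (Lp.memLp _)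
  tendsto := by
    have h := tendsto_diagonal_damping hC (ContinuousLinearMap.adjoint
      (orthogonalFamily_sourceMode hγ hr).linearIsometry.toContinuousLinearMap f)
    have h' := ENNReal.tendsto_ofReal h
    rw [ENNReal.ofReal_zero] at h'
    refine h'.congr' ?_
    filter_upwards [self_mem_nhdsWithin] with ε hε
    rw [← eLpNorm_congr_ae ((lerayShift_ae_eq hγ hr hC hε f).sub (ae_eq_refl _)),
      ← eLpNorm_congr_ae (Lp.coeFn_sub _ _), ← Lp.enorm_def, ← ofReal_norm]
    congr 1
    simp only [weightedSum, ContinuousLinearMap.comp_apply]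
    rw [← map_sub]
    exact ((orthogonalFamily_rangeMode hγ hr).linearIsometry.norm_map _).symm

end

/-! ### Spectral description of the two products. -/

theorem theorem1p4 (γ : ℝ) (hγ : 1 < γ) (r : ℝ) (hr : r ∈ Set.Ioo (-1) (2 * γ - 1)) :
    ∃ L : LerayL2 γ r →L[ℂ] LerayL2 γ r,
      (∀ f, IsLerayTransform γ r f (L f)) ∧
      ∀ T : LerayL2 γ r →L[ℂ] LerayL2 γ r,
        (T = (ContinuousLinearMap.adjoint L).comp L ∨
          T = L.comp (ContinuousLinearMap.adjoint L)) →
        (∃ (ι : Type) (b : HilbertBasis ι ℂ (LerayL2 γ r)), ∀ i, ∃ c : ℂ,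
          Module.End.HasEigenvector (T : LerayL2 γ r →ₗ[ℂ] LerayL2 γ r) c (b i)) ∧
        {c : ℂ | Module.End.HasEigenvalue (T : LerayL2 γ r →ₗ[ℂ] LerayL2 γ r) c} =
          {0} ∪ Set.range (fun k : ℕ => (leraySymbol γ r k : ℂ)) ∧
        spectrum ℂ T =
          closure ({0} ∪ Set.range (fun k : ℕ => (leraySymbol γ r k : ℂ))) := by
  obtain ⟨C, hC⟩ := exists_leraySymbol_le hγ r
  have hV := orthogonalFamily_rangeMode hγ hr
  have hW := orthogonalFamily_sourceMode hγ hr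
  obtain ⟨v, hv0, hvV, hvW⟩ := exists_orthogonal_modes hγ hr
  have hD := isSelfAdjoint_diagonal (K := HalfLineL2) (fun k => √(leraySymbol γ r k)) (√C)
    fun k => norm_sqrt_leraySymbol_smul_le hC k ContinuousLinearMap.norm_id_le
  refine ⟨_, isLerayTransform_weightedSum hγ hr hC, fun T hT => ?_⟩
  -- The weights √C_k are real, so the adjoint just exchanges the two families, and one lemma serves
  -- both choices of T.
  rw [weightedSum_adjoint hV hW hD] at hT
  have hsq : (fun k : ℕ => ((√(leraySymbol γ r k) ^ 2 : ℝ) : ℂ)) =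
      fun k : ℕ => (leraySymbol γ r k : ℂ) := by
    ext k
    rw [Real.sq_sqrt (leraySymbol_pos hγ hr k).le]
  obtain ⟨ι, b, d, hb, hd⟩ : ∃ (ι : Type) (b : HilbertBasis ι ℂ (LerayL2 γ r)) (d : ι → ℂ),
      (∀ i, T (b i) = d i • b i) ∧
        Set.range d = {0} ∪ Set.range fun k : ℕ => (leraySymbol γ r k : ℂ) := by
    rw [← hsq]
    rcases hT with rfl | rfl
    · exact exists_eigenbasis_weightedSum hV hW ⟨v, hv0, hvW⟩ _ rfl
    · exact exists_eigenbasis_weightedSum hW hV ⟨v, hv0, hvV⟩ _ rfl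
  refine ⟨⟨ι, b, fun i => ⟨d i, hasEigenvector_of_eigenbasis hb i⟩⟩, ?_, ?_⟩
  · ext z
    rw [← hd]
    exact hasEigenvalue_iff_of_eigenbasis hb z
  · rw [← hd]
    exact spectrum_of_eigenbasis hb
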